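/- Let $A=(0,1)\times S^1$ be the open annulus and let $f:A\to A$ be a covering map of degree $d$ with $|d|>1$, where the degree is the integer $d$ such that $f_*:H_1(A,\mathbb Z)\to H_1(A,\mathbb Z)\cong\mathbb Z$ is multiplication by $d$. An orbit of a self-map $g$ of a space $X$ is a sequence $(z_n)_{n\in\mathbb Z}$ in $X$ with $z_{n+1}=g(z_n)$ for all $n\in\mathbb Z$. The inverse limit $X_g$ is the set of all orbits of $g$, with the topology induced by the product topology of $X^{\mathbb Z}$, and $\sigma_g:X_g\to X_g$, $(\sigma_g z)_n=z_{n+1}$, is the shift homeomorphism. For $m_d:S^1\to S^1$, $m_d(z)=z^d$, write $S_d$ for the inverse limit of $m_d$ and $\sigma_d=\sigma_{m_d}$ (the solenoid). A subset of $A$ is essential if for each of its open neighbourhoods $U$ in $A$ the map $H_1(U,\mathbb Z)\to H_1(A,\mathbb Z)$ induced by inclusion is surjective. A fundamental domain for $f$ is an essential subset $A_0\subset A$ homeomorphic to the compact annulus $[0,1]\times S^1$ such that 1. each connected component of the boundary of $A_0$ is a simple closed curve; 2. for every orbit $(z_n)_{n\in\mathbb Z}$ of $f$, the number of $n\in\mathbb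 Z$ with $z_n\in A_0$ is $1$ or $2$; 3. $f(A_0)$ does not intersect the interior of $A_0$. Proposition. If $f$ has a fundamental domain, then $\sigma_f$ is semiconjugate to $\sigma_d$: there exists a continuous surjective map $h:A_f\to S_d$ such that $h\circ\sigma_f=\sigma_d\circ h$. -/

import Mathlib

/-- The open annulus `A = (0,1) × S¹`. -/
abbrev Annulus : Type := Set.Ioo (0 : ℝ) 1 × Circle

/-- The closed curve `γ : S¹ → A` has winding number `n`: a continuous choice `θ` of the angular
coordinate of `γ`, measured in full turns, increases by `n` along one turn. This is the class of
`γ` in `H₁(A, ℤ) ≅ ℤ`. -/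
def HasWindingNumber (γ : C(Circle, Annulus)) (n : ℤ) : Prop :=
  ∃ θ : ℝ → ℝ, Continuous θ ∧
    (∀ t : ℝ, (γ (Circle.exp (2 * Real.pi * t))).2 = Circle.exp (2 * Real.pi * θ t)) ∧
    ∀ t : ℝ, θ (t + 1) = θ t + n

/-- The self-map `f` of the annulus has degree `d`: on `H₁(A, ℤ) ≅ ℤ` it acts as multiplication
by `d`. -/
def HasDegree (f : C(Annulus, Annulus)) (d : ℤ) : Prop :=
  ∀ (γ : C(Circle, Annulus)) (n : ℤ), HasWindingNumber γ n → HasWindingNumber (f.comp γ) (d * n)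

/-- The open set `U ⊆ A` is essential: the image of `H₁(U, ℤ)` in `H₁(A, ℤ) ≅ ℤ`, which is the
subgroup generated by the winding numbers of the closed curves in `U`, is all of `ℤ`. -/
def IsEssentialOpen (U : Set Annulus) : Prop :=
  AddSubgroup.closure
    {n : ℤ | ∃ γ : C(Circle, Annulus), Set.range γ ⊆ U ∧ HasWindingNumber γ n} = ⊤

/-- A subset of `A` is essential if each of its open neighbourhoods in `A` is. -/
def IsEssential (X : Set Annulus) : Prop :=
  ∀ U : Set Annulus, IsOpen U → X ⊆ U → IsEssentialOpen U

/-- A simple closed curve in `A`: the image of an injective continuous map `S¹ → A`. -/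
def IsSimpleClosedCurve (L : Set Annulus) : Prop :=
  ∃ γ : C(Circle, Annulus), Function.Injective γ ∧ Set.range γ = L

/-- The inverse limit set `X_f` of a self-map `f` of `X`: the set of its (two-sided) orbits, with
the topology induced by the product topology of `ℤ → X`. -/
abbrev InverseLimit {X : Type*} (f : X → X) : Type _ :=
  {z : ℤ → X // ∀ n : ℤ, z (n + 1) = f (z n)}

/-- The shift homeomorphism `σ_f` of the inverse limit set, `(σ_f z)ₙ = zₙ₊₁`. -/
def shift {X : Type*} [TopologicalSpace X] (f : X → X) : InverseLimit f ≃ₜ InverseLimit f where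
  toFun z := ⟨fun n => z.1 (n + 1), fun n => z.2 (n + 1)⟩
  invFun z := ⟨fun n => z.1 (n - 1), fun n => by
    have h := z.2 (n - 1)
    rw [sub_add_cancel] at h
    simpa only [add_sub_cancel_right] using h⟩
  left_inv z := by
    apply Subtype.ext
    funext n
    simp
  right_inv z := by
    apply Subtype.ext
    funext n
    simp
  continuous_toFun := by
    refine Continuous.subtype_mk (continuous_pi fun n => ?_) _
    exact (continuous_apply (n + 1)).comp continuous_subtype_val
  continuous_invFun := by
    refine Continuous.subtype_mk (continuous_pi fun n => ?_) _
    exact (continuous_apply (n - 1)).comp continuous_subtype_val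

/-- `A₀` is a fundamental domain for the self-map `f` of the annulus. -/
structure IsFundamentalDomain (f : Annulus → Annulus) (A₀ : Set Annulus) : Prop where
  /-- `A₀` is a compact annulus. -/
  annulus : Nonempty (A₀ ≃ₜ Set.Icc (0 : ℝ) 1 × Circle)
  /-- `A₀` is essential in `A`. -/
  essential : IsEssential A₀
  /-- Each component of the boundary of `A₀` is a simple closed curve. -/
  boundary : ∀ x ∈ frontier A₀, IsSimpleClosedCurve (connectedComponentIn (frontier A₀) x)
  /-- Every two-sided orbit is in `A₀` at one time at least and at two times at most. -/
  hits : ∀ z : InverseLimit f,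
    1 ≤ {n : ℤ | z.1 n ∈ A₀}.encard ∧ {n : ℤ | z.1 n ∈ A₀}.encard ≤ 2
  /-- `f(A₀)` does not meet the interior of `A₀`. -/
  disjoint_interior : Disjoint (f '' A₀) (interior A₀)

/-- The map `m_d(z) = z ^ d` of the circle. -/
noncomputable def circlePow (d : ℤ) : Circle → Circle := fun z => z ^ d

open Real Set Filter Topology

/-! Lift `f` to a homeomorphism `F` of the strip. Its angular part is `d * p.2 + φ (proj p)` for a
function `φ` on the annulus, so `z ↦ (zₙ.2 * turn (u (σⁿ z)))ₙ` is an equivariant map to the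
solenoid as soon as `u ∘ σ = d u - φ(z₀)`. For bounded `φ` the series `∑ φ(fⁿ x) / dⁿ⁺¹` would be a
solution. Near the ends `φ` may be unbounded, and the dynamics must replace the estimate.

The fundamental domain cuts off a closed set `P` with `f P ⊆ P` and `f² P ⊆ interior P` such that
every orbit enters `P` and has been outside it (`IsFundamentalDomain.exists_isAbsorbing`). With a
cutoff `b` equal to `1` on `P`, sum `(1 - b) φ` over the future and `b φ` over the past: both sums
are locally finite, and their difference is `u` (`IsAbsorbing.exists_cohomological_solution`).

Surjectivity: while the past stays away from `P`, `u` is a function `g` of `z₀`, and `k p = p.2 + g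
(proj p)` satisfies `k ∘ F = d k`. Any solenoid point can then be followed backwards
(`exists_backward_sequence`), starting on the second preimage of an essential curve that misses `P`,
where `k` takes all real values.

Construction of `P`: the middle circle of `A₀` separates the ends, and the connected set `f(A₀)`
lies on one side of it; `P` is that side without the open core of `A₀`. If `P` were not forward
invariant, `f` would move a neighbourhood of the other end off itself. Then, as `|d| > 1`, `F` has a
fixed point by Poincaré–Miranda, whereas a constant orbit visits `A₀` never or infinitely often. -/

/-! ### The angular coordinate, measured in full turns -/

/-- The point of the circle at angle `t`, measured in full turns. -/
noncomputable def turn (t : ℝ) : Circle := Circle.exp (2 * π * t)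

lemma continuous_turn : Continuous turn := by unfold turn; fun_prop

lemma turn_add (s t : ℝ) : turn (s + t) = turn s * turn t := by
  simp [turn, mul_add, Circle.exp_add]

lemma turn_int (m : ℤ) : turn m = 1 := Circle.exp_two_pi_mul_int m

lemma turn_add_int (s : ℝ) (m : ℤ) : turn (s + m) = turn s := by
  rw [turn_add, turn_int, mul_one]

lemma turn_eq_iff {s t : ℝ} : turn s = turn t ↔ ∃ m : ℤ, s = t + m := by
  unfold turn
  rw [Circle.exp_eq_exp]
  refine exists_congr fun m => ⟨fun h => ?_, fun h => by rw [h]; ring⟩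
  have : 2 * π * s = 2 * π * (t + m) := by rw [h]; ring
  exact mul_left_cancel₀ (by positivity) this

lemma turn_surjective : Function.Surjective turn := fun w => by
  obtain ⟨x, hx⟩ := Circle.exp_surjective w
  refine ⟨x / (2 * π), ?_⟩
  rw [turn, mul_div_cancel₀ x (by positivity), hx]

lemma turn_int_mul (d : ℤ) (t : ℝ) : turn (d * t) = turn t ^ d := by
  rw [turn, turn, ← Circle.exp_zsmul]
  congr 1
  simp only [zsmul_eq_mul]
  ring

lemma turn_neg (t : ℝ) : turn (-t) = (turn t)⁻¹ := by
  have := turn_int_mul (-1) t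
  simpa using this

lemma coe_turn (t : ℝ) : (turn t : ℂ) = Complex.exp (2 * π * t * Complex.I) := by
  simp [turn, Circle.coe_exp]

lemma isOpenMap_turn : IsOpenMap turn :=
  isLocalHomeomorph_circleExp.isOpenMap.comp (Homeomorph.mulLeft₀ (2 * π) (by positivity)).isOpenMap

lemma exists_turn_lift {X : Type*} [TopologicalSpace X] [SimplyConnectedSpace X]
    [LocallyPathConnectedSpace X] (g : X → Circle) (hg : Continuous g) :
    ∃ θ : X → ℝ, Continuous θ ∧ ∀ x, turn (θ x) = g x := by
  obtain ⟨x₀⟩ : Nonempty X := inferInstance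
  obtain ⟨y, hy⟩ := Circle.exp_surjective (g x₀)
  obtain ⟨F, ⟨-, hF⟩, -⟩ := Circle.isCoveringMap_exp.existsUnique_continuousMap_lifts ⟨g, hg⟩ x₀ y hy
  refine ⟨fun x => F x / (2 * π), by fun_prop, fun x => ?_⟩
  rw [turn, mul_div_cancel₀ _ (by positivity)]
  exact congrFun hF x

lemma exists_int_eq_of_turn_eq {X : Type*} [TopologicalSpace X] [PreconnectedSpace X] [Nonempty X]
    {θ θ' : X → ℝ} (h : Continuous θ) (h' : Continuous θ') (e : ∀ x, turn (θ x) = turn (θ' x)) :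
    ∃ m : ℤ, ∀ x, θ x = θ' x + m := by
  obtain ⟨x₀⟩ : Nonempty X := inferInstance
  obtain ⟨m, hm⟩ := turn_eq_iff.1 (e x₀)
  refine ⟨m, fun x => ?_⟩
  have := Circle.isCoveringMap_exp.eq_of_comp_eq (g₁ := fun x => 2 * π * θ x)
    (g₂ := fun x => 2 * π * (θ' x + m)) (by fun_prop) (by fun_prop)
    (funext fun x => (e x).trans (turn_add_int _ m).symm) x₀ (by simp [hm])
  exact mul_left_cancel₀ (by positivity) (congrFun this x)

/-! ### The index of a closed curve in the punctured plane -/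

lemma exists_log_lift {X : Type*} [TopologicalSpace X] [SimplyConnectedSpace X]
    [LocallyPathConnectedSpace X] (g : X → ℂ) (hg : Continuous g) (h0 : ∀ x, g x ≠ 0) :
    ∃ L : X → ℂ, Continuous L ∧ ∀ x, Complex.exp (L x) = g x := by
  obtain ⟨x₀⟩ : Nonempty X := inferInstance
  obtain ⟨F, ⟨-, hF⟩, -⟩ := Complex.isCoveringMap_exp.existsUnique_continuousMap_lifts
    ⟨fun x => (⟨g x, h0 x⟩ : {z : ℂ // z ≠ 0}), by fun_prop⟩ x₀ (Complex.log (g x₀))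
    (Subtype.ext (Complex.exp_log (h0 x₀)))
  exact ⟨F, F.continuous, fun x => congrArg Subtype.val (congrFun hF x)⟩

lemma exists_int_eq_of_exp_eq {X : Type*} [TopologicalSpace X] [PreconnectedSpace X] [Nonempty X]
    {L L' : X → ℂ} (h : Continuous L) (h' : Continuous L')
    (e : ∀ x, Complex.exp (L x) = Complex.exp (L' x)) :
    ∃ m : ℤ, ∀ x, L x = L' x + m * (2 * π * Complex.I) := by
  obtain ⟨x₀⟩ : Nonempty X := inferInstance
  obtain ⟨m, hm⟩ := Complex.exp_eq_exp_iff_exists_int.1 (e x₀)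
  refine ⟨m, fun x => ?_⟩
  exact congrFun (Complex.isCoveringMap_exp.eq_of_comp_eq (g₁ := L)
    (g₂ := fun x => L' x + m * (2 * π * Complex.I)) h (by fun_prop)
    (funext fun x => Subtype.ext <| (e x).trans <|
      Complex.exp_eq_exp_iff_exists_int.2 ⟨-m, by push_cast; ring⟩) x₀ hm) x

/-- The closed curve `g : ℝ → ℂ ∖ {0}` of period `1` has index `k` about `0`. -/
def HasIndex (g : ℝ → ℂ) (k : ℤ) : Prop :=
  ∃ L : ℝ → ℂ, Continuous L ∧ (∀ t, Complex.exp (L t) = g t) ∧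
    ∀ t, L (t + 1) = L t + k * (2 * π * Complex.I)

/-- A logarithm exists on the whole parameter plane, and its increment over one period is a
continuous multiple of `2πi`, hence the same for all `s`. -/
lemma exists_hasIndex_of_homotopy (G : ℝ × ℝ → ℂ) (hG : Continuous G) (h0 : ∀ p, G p ≠ 0)
    (hp : ∀ s t, G (s, t + 1) = G (s, t)) : ∃ k : ℤ, ∀ s, HasIndex (fun t => G (s, t)) k := by
  obtain ⟨L, hL, hexp⟩ := exists_log_lift G hG h0
  obtain ⟨k, hk⟩ := exists_int_eq_of_exp_eq (L := fun p : ℝ × ℝ => L (p.1, p.2 + 1)) (L' := L)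
    (by fun_prop) hL (fun p => by rw [hexp, hexp, hp])
  exact ⟨k, fun s => ⟨fun t => L (s, t), by fun_prop, fun t => hexp _, fun t => hk (s, t)⟩⟩

lemma abs_sub_lt_pi_of_cos_ne_zero {D : ℝ → ℝ} (hD : Continuous D) (h : ∀ t, Real.cos (D t) ≠ 0)
    (x y : ℝ) : |D x - D y| < π := by
  wlog hxy : D x ≤ D y generalizing x y
  · rw [abs_sub_comm]
    exact this y x (le_of_not_ge hxy)
  rw [abs_sub_comm, abs_of_nonneg (sub_nonneg.2 hxy)]
  by_contra! hc
  -- `π / 2 + n * π` is the first zero of the cosine at or above `D x`; an interval of length `π`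
  -- must contain it.
  set n : ℤ := ⌈D x / π - 1 / 2⌉
  have h1 : D x ≤ π / 2 + n * π := by
    have := Int.le_ceil (D x / π - 1 / 2)
    have : D x / π ≤ n + 1 / 2 := by linarith
    rw [div_le_iff₀ pi_pos] at this
    linarith
  have h2 : π / 2 + n * π ≤ D y := by
    have := Int.ceil_lt_add_one (D x / π - 1 / 2)
    have : n - 1 / 2 < D x / π := by linarith
    rw [lt_div_iff₀ pi_pos] at this
    linarith
  obtain ⟨t, ht⟩ := mem_range_of_exists_le_of_exists_ge hD ⟨x, h1⟩ ⟨y, h2⟩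
  apply h t
  rw [ht, Real.cos_add_int_mul_pi, Real.cos_pi_div_two, mul_zero]

/-- A form of Rouché's theorem: the quotient stays in the right half-plane, so its argument varies
by less than `π` and cannot gain a full turn. -/
lemma HasIndex.eq_of_re_div_pos {g g' : ℝ → ℂ} {k k' : ℤ} (h : HasIndex g k) (h' : HasIndex g' k')
    (hr : ∀ t, 0 < (g' t / g t).re) : k' = k := by
  obtain ⟨L, hL, hexp, hk⟩ := h
  obtain ⟨L', hL', hexp', hk'⟩ := h'
  have hc : ∀ t, Real.cos (L' t - L t).im ≠ 0 := fun t hc => by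
    have := hr t
    rw [← hexp, ← hexp', ← Complex.exp_sub, Complex.exp_re, hc, mul_zero] at this
    exact lt_irrefl _ this
  have := abs_sub_lt_pi_of_cos_ne_zero (D := fun t => (L' t - L t).im) (by fun_prop) hc (0 + 1) 0
  rw [hk, hk'] at this
  have e : (L' 0 + k' * (2 * π * Complex.I) - (L 0 + k * (2 * π * Complex.I))).im
      - (L' 0 - L 0).im = (k' - k : ℤ) * (2 * π) := by
    simp
    ring
  rw [e, abs_mul, abs_of_pos (by positivity : 0 < 2 * π)] at this
  have h1 : |((k' - k : ℤ) : ℝ)| < 1 := by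
    by_contra! hcon
    nlinarith [pi_pos]
  rw [← Int.cast_abs] at h1
  have h2 : |k' - k| < 1 := by exact_mod_cast h1
  have := Int.abs_lt_one_iff.1 h2
  omega

lemma hasIndex_const {c : ℂ} (hc : c ≠ 0) : HasIndex (fun _ => c) 0 :=
  ⟨fun _ => Complex.log c, continuous_const, fun _ => Complex.exp_log hc, fun t => by simp⟩

/-- Over each half period the logarithm gains the same `(2m + 1)πi`, so the index is the odd number
`2m + 1`. -/
lemma HasIndex.ne_zero_of_odd {g : ℝ → ℂ} {k : ℤ} (h : HasIndex g k)
    (ho : ∀ t, g (t + 1 / 2) = - g t) : k ≠ 0 := by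
  obtain ⟨L, hL, hexp, hk⟩ := h
  obtain ⟨m, hm⟩ := exists_int_eq_of_exp_eq (L := fun t => L (t + 1 / 2))
    (L' := fun t => L t + π * Complex.I) (by fun_prop) (by fun_prop)
    (fun t => by rw [hexp, ho, Complex.exp_add, Complex.exp_pi_mul_I, hexp]; ring)
  have h1 := hm 0
  have h2 := hm (1 / 2)
  have h3 := hk 0
  rw [show (0 : ℝ) + 1 = 1 / 2 + 1 / 2 by norm_num, h2, show (1 / 2 : ℝ) = 0 + 1 / 2 by norm_num,
    h1] at h3
  have h4 : ((2 * m + 1 : ℤ) : ℂ) * (2 * π * Complex.I) = k * (2 * π * Complex.I) := by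
    push_cast
    linear_combination h3
  have h5 := Int.cast_injective (mul_right_cancel₀ Complex.two_pi_I_ne_zero h4)
  omega

/-! ### Invariance of domain in the plane -/

lemma continuous_coe_turn : Continuous fun t : ℝ => (turn t : ℂ) :=
  continuous_subtype_val.comp continuous_turn

lemma turn_add_one (t : ℝ) : turn (t + 1) = turn t := by
  simpa using turn_add_int t 1

lemma coe_turn_add_half (t : ℝ) : (turn (t + 1 / 2) : ℂ) = -turn t := by
  rw [coe_turn, coe_turn]
  push_cast
  rw [show 2 * π * ((t : ℂ) + 1 / 2) * Complex.I = 2 * π * t * Complex.I + π * Complex.I by ring,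
    Complex.exp_add, Complex.exp_pi_mul_I]
  ring

lemma norm_coe_turn (t : ℝ) : ‖(turn t : ℂ)‖ = 1 := Circle.norm_coe _

lemma norm_sub_one_lt_imp_re_pos {z : ℂ} (h : ‖z - 1‖ < 1) : 0 < z.re := by
  have := (abs_le.1 (Complex.abs_re_le_norm (z - 1))).1
  simp only [Complex.sub_re, Complex.one_re] at this
  linarith

/-- The parameter `s` clamped to the unit interval. -/
noncomputable def clamp (s : ℝ) : ℝ := max 0 (min 1 s)

lemma continuous_clamp : Continuous clamp := by unfold clamp; fun_prop

lemma clamp_nonneg (s : ℝ) : 0 ≤ clamp s := le_max_left _ _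

lemma clamp_le_one (s : ℝ) : clamp s ≤ 1 := max_le zero_le_one (min_le_left _ _)

lemma clamp_of_mem {s : ℝ} (h0 : 0 ≤ s) (h1 : s ≤ 1) : clamp s = s := by simp [clamp, h0, h1]

/-- **Invariance of domain** in the plane. -/
theorem image_closedBall_mem_nhds {e : ℂ → ℂ} (he : Continuous e)
    (hi : InjOn e (Metric.closedBall 0 1)) : e '' Metric.closedBall 0 1 ∈ 𝓝 (e 0) := by
  have hmem : ∀ (c t : ℝ), |c| ≤ 1 → (c : ℂ) * turn t ∈ Metric.closedBall (0 : ℂ) 1 :=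
    fun c t hc => by simpa [norm_coe_turn] using hc
  -- The two arguments of `e` always differ by `turn t`, so injectivity keeps the difference
  -- nonzero. At `s = 0` it is `e (turn t) - e 0`, at `s = 1` it is odd: the boundary curve has
  -- nonzero index about `e 0`.
  obtain ⟨k, hk⟩ := exists_hasIndex_of_homotopy
    (fun p => e (((1 / (1 + clamp p.1) : ℝ) : ℂ) * turn p.2) -
      e (((-clamp p.1 / (1 + clamp p.1) : ℝ) : ℂ) * turn p.2))
    (by
      have h1 : Continuous fun p : ℝ × ℝ => 1 + clamp p.1 :=
        continuous_const.add (continuous_clamp.comp continuous_fst)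
      have h2 : ∀ p : ℝ × ℝ, 1 + clamp p.1 ≠ 0 := fun p => by linarith [clamp_nonneg p.1]
      have h3 := continuous_coe_turn.comp (continuous_snd (X := ℝ) (Y := ℝ))
      have h4 := continuous_clamp.comp (continuous_fst (X := ℝ) (Y := ℝ))
      exact (he.comp ((Complex.continuous_ofReal.comp (continuous_const.div h1 h2)).mul h3)).sub
        (he.comp ((Complex.continuous_ofReal.comp (h4.neg.div h1 h2)).mul h3)))
    (fun p h => by
      have h0 := clamp_nonneg p.1
      have h1 := clamp_le_one p.1
      have h2 : 0 < 1 + clamp p.1 := by linarith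
      have := hi (hmem _ _ ?_) (hmem _ _ ?_) (sub_eq_zero.1 h)
      · have h3 := Complex.ofReal_injective (mul_right_cancel₀ (Circle.coe_ne_zero _) this)
        rw [div_left_inj' h2.ne'] at h3
        linarith
      · rw [abs_of_nonneg (by positivity), div_le_one h2]
        linarith
      · rw [abs_div, abs_neg, abs_of_nonneg h0, abs_of_pos h2, div_le_one h2]
        linarith)
    (fun s t => by simp only [turn_add_one])
  have hodd : k ≠ 0 := (hk 1).ne_zero_of_odd fun t => by
    simp only [clamp_of_mem zero_le_one le_rfl, coe_turn_add_half]
    rw [neg_sub]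
    push_cast
    ring_nf
  have h0 : HasIndex (fun t => e (turn t) - e 0) k := by
    simpa [clamp_of_mem le_rfl zero_le_one] using hk 0
  have hne : ∀ t, e (turn t) - e 0 ≠ 0 := fun t h => by
    have := hi (by simpa using hmem 1 t (by simp)) (by simp) (sub_eq_zero.1 h)
    exact Circle.coe_ne_zero _ this
  obtain ⟨μ, hμ, hle⟩ : ∃ μ > 0, ∀ w ∈ Metric.sphere (0 : ℂ) 1, μ ≤ ‖e w - e 0‖ := by
    obtain ⟨w₀, hw₀, hmin⟩ := (isCompact_sphere (0 : ℂ) 1).exists_isMinOn ⟨1, by simp⟩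
      (f := fun w => ‖e w - e 0‖) (by fun_prop)
    refine ⟨_, norm_pos_iff.2 fun h => ?_, fun w hw => hmin hw⟩
    have := hi (Metric.sphere_subset_closedBall hw₀) (by simp) (sub_eq_zero.1 h)
    rw [this] at hw₀
    simp at hw₀
  refine Filter.mem_of_superset (Metric.ball_mem_nhds _ hμ) fun v hv => ?_
  by_contra hcon
  -- If `v` is not a value, shrinking the circle to its centre shows that the boundary curve has
  -- index `0` about `v`; but `v` is so close to `e 0` that this index is also `k`.
  obtain ⟨k', hk'⟩ := exists_hasIndex_of_homotopy
    (fun p => e ((clamp p.1 : ℂ) * turn p.2) - v)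
    ((he.comp ((Complex.continuous_ofReal.comp (continuous_clamp.comp continuous_fst)).mul
      (continuous_coe_turn.comp continuous_snd))).sub continuous_const)
    (fun p h => hcon ⟨_, hmem _ _ (by
      rw [abs_of_nonneg (clamp_nonneg _)]; exact clamp_le_one _), sub_eq_zero.1 h⟩)
    (fun s t => by simp only [turn_add_one])
  have hk0 : k' = 0 := by
    have h1 := hk' 0
    simp only [clamp_of_mem le_rfl zero_le_one, Complex.ofReal_zero, zero_mul] at h1
    have hv0 : e 0 - v ≠ 0 := fun h => hcon ⟨0, by simp, sub_eq_zero.1 h⟩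
    exact (hasIndex_const hv0).eq_of_re_div_pos h1 fun t => by simp [div_self hv0]
  have hkk : k' = k := by
    have h1 := hk' 1
    simp only [clamp_of_mem zero_le_one le_rfl, Complex.ofReal_one, one_mul] at h1
    refine h0.eq_of_re_div_pos h1 fun t => norm_sub_one_lt_imp_re_pos ?_
    rw [div_sub_one (hne t), norm_div, div_lt_one (norm_pos_iff.2 (hne t))]
    rw [show e (turn t) - v - (e (turn t) - e 0) = -(v - e 0) by ring, norm_neg]
    exact (mem_ball_iff_norm.1 hv).trans_le (hle _ (by simp [norm_coe_turn]))
  exact hodd (hkk ▸ hk0)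

/-! ### The universal cover of the annulus -/

/-- The open strip, the universal cover of the annulus. -/
abbrev Strip : Type := Ioo (0 : ℝ) 1 × ℝ

/-- The universal covering of the annulus. -/
noncomputable def proj (p : Strip) : Annulus := (p.1, turn p.2)

instance : ContractibleSpace (Ioo (0 : ℝ) 1) :=
  (convex_Ioo (0 : ℝ) 1).contractibleSpace ⟨1 / 2, by norm_num⟩

instance : LocallyPathConnectedSpace (Ioo (0 : ℝ) 1) := isOpen_Ioo.locallyPathConnectedSpace

instance : LocallyPathConnectedSpace Circle :=
  (isOpenMap_turn.isQuotientMap continuous_turn turn_surjective).locallyPathConnectedSpace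

lemma continuous_proj : Continuous proj :=
  continuous_fst.prodMk (continuous_turn.comp continuous_snd)

lemma isOpenMap_proj : IsOpenMap proj := IsOpenMap.id.prodMap isOpenMap_turn

lemma proj_surjective : Function.Surjective proj := fun x => by
  obtain ⟨t, ht⟩ := turn_surjective x.2
  exact ⟨(x.1, t), Prod.ext rfl ht⟩

/-- The translation of the strip by `m` full turns. -/
def deck (m : ℤ) (p : Strip) : Strip := (p.1, p.2 + m)

lemma continuous_deck (m : ℤ) : Continuous (deck m) := by unfold deck; fun_prop

lemma proj_deck (m : ℤ) (p : Strip) : proj (deck m p) = proj p :=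
  Prod.ext rfl (turn_add_int _ _)

lemma deck_deck (m n : ℤ) (p : Strip) :
    deck m (deck n p) = deck (n + m) p := by
  simp [deck, add_assoc]

@[simp] lemma deck_zero (p : Strip) : deck 0 p = p := by simp [deck]

lemma proj_eq_iff {p q : Strip} : proj p = proj q ↔ ∃ m : ℤ, p = deck m q := by
  simp only [proj, Prod.ext_iff, deck, turn_eq_iff, exists_and_left]

/-! ### Essential curves separate the ends of the annulus -/

/-- `E` is the quotient of the curve and the path in exponential coordinates, so disjointness says
`E ≠ 1`. The index of `E - 1` in `t` is constant in `s`: it is `m` at `s = 0`, where `|E| > 1`, and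
`0` at `s = 1`, where `|E| < 1`. -/
lemma index_eq_zero_of_disjoint {ρ θ r a : ℝ → ℝ} {m : ℤ} (hρ : Continuous ρ) (hθ : Continuous θ)
    (hr : Continuous r) (ha : Continuous a) (hρ1 : ∀ t, ρ (t + 1) = ρ t)
    (hθ1 : ∀ t, θ (t + 1) = θ t + m) (h0 : ∀ t, r 0 < ρ t) (h1 : ∀ t, ρ t < r 1)
    (hne : ∀ s t, ρ t = r s → turn (θ t) ≠ turn (a s)) : m = 0 := by
  set E : ℝ × ℝ → ℂ := fun p =>
    Complex.exp ((2 * π * (ρ p.2 - r p.1) : ℝ) + (2 * π * (θ p.2 - a p.1) : ℝ) * Complex.I) with hE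
  have hEn : ∀ s t, ‖E (s, t)‖ = Real.exp (2 * π * (ρ t - r s)) := fun s t => by
    simp only [hE, Complex.norm_exp]
    congr 1
    simp
  have hE1 : ∀ p, E p - 1 ≠ 0 := fun p h => by
    have h2 := hEn p.1 p.2
    rw [show E (p.1, p.2) = 1 from sub_eq_zero.1 h, norm_one, eq_comm, Real.exp_eq_one_iff] at h2
    have h3 : ρ p.2 = r p.1 := by
      have := (mul_eq_zero.1 h2).resolve_left (by positivity)
      linarith
    apply hne _ _ h3
    have h4 := sub_eq_zero.1 h
    simp only [hE, h3, sub_self, mul_zero, Complex.ofReal_zero, zero_add] at h4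
    have h5 : turn (θ p.2 - a p.1) = 1 := by
      ext
      rw [coe_turn, ← Complex.ofReal_one] at *
      rw [show ((1 : Circle) : ℂ) = (1 : ℝ) by simp, ← h4]
      push_cast
      rfl
    have h6 := turn_add (θ p.2 - a p.1) (a p.1)
    rwa [h5, one_mul, sub_add_cancel] at h6
  have hEp : ∀ s t, E (s, t + 1) = E (s, t) := fun s t => by
    simp only [hE, hρ1, hθ1]
    rw [Complex.exp_eq_exp_iff_exists_int]
    exact ⟨m, by push_cast; ring⟩
  obtain ⟨k, hk⟩ := exists_hasIndex_of_homotopy (fun p => E p - 1) (by fun_prop) hE1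
    (fun s t => by simp only [hEp])
  have hk0 : k = 0 := by
    refine (hasIndex_const (c := -1) (by simp)).eq_of_re_div_pos (hk 1) fun t => ?_
    refine norm_sub_one_lt_imp_re_pos ?_
    rw [show (E (1, t) - 1) / -1 - 1 = - E (1, t) by ring, norm_neg, hEn, Real.exp_lt_one_iff]
    nlinarith [h1 t, pi_pos]
  have hkm : k = m := by
    have hI : HasIndex (fun t => E (0, t)) m :=
      ⟨fun t => (2 * π * (ρ t - r 0) : ℝ) + (2 * π * (θ t - a 0) : ℝ) * Complex.I, by fun_prop,
        fun t => rfl, fun t => by simp only [hρ1, hθ1]; push_cast; ring⟩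
    refine hI.eq_of_re_div_pos (hk 0) fun t => norm_sub_one_lt_imp_re_pos ?_
    have : E (0, t) ≠ 0 := Complex.exp_ne_zero _
    rw [div_sub_one this, norm_div, sub_sub_cancel_left, norm_neg, norm_one, hEn,
      div_lt_one (Real.exp_pos _), Real.one_lt_exp_iff]
    nlinarith [h0 t, pi_pos]
  omega

/-- An essential closed curve meets every path that joins its two sides. -/
lemma path_meets_of_winding_ne_zero {γ : C(Circle, Annulus)} {m : ℤ} (hm : m ≠ 0)
    (hγ : HasWindingNumber γ m) {x y : Annulus} (p : Path x y)
    (hx : ∀ w, (x.1 : ℝ) < (γ w).1) (hy : ∀ w, ((γ w).1 : ℝ) < y.1) :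
    ∃ s, p s ∈ range γ := by
  by_contra! hcon
  obtain ⟨θ, hθ, hθγ, hθ1⟩ := hγ
  obtain ⟨a, ha, hap⟩ := exists_turn_lift (fun s : ℝ => (p.extend s).2)
    (continuous_snd.comp p.continuous_extend)
  apply hm
  refine index_eq_zero_of_disjoint (ρ := fun t => (γ (turn t)).1)
    (r := fun s => (p.extend s).1)
    (continuous_subtype_val.comp (continuous_fst.comp (γ.continuous.comp continuous_turn)))
    hθ (continuous_subtype_val.comp (continuous_fst.comp p.continuous_extend)) ha
    (fun t => by simp only [turn_add_one]) hθ1 (fun t => by simpa using hx _)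
    (fun t => by simpa using hy _) fun s t h1 h2 => ?_
  have h3 : p.extend s = γ (turn t) := by
    refine Prod.ext (Subtype.ext h1.symm) ?_
    rw [← hap, ← h2]
    exact (hθγ t).symm
  refine hcon (projIcc 0 1 zero_le_one s) ⟨turn t, ?_⟩
  rw [← h3]
  rfl

/-! ### Embedded compact annuli -/

lemma exists_descent {X Y : Type*} [TopologicalSpace X] [TopologicalSpace Y] {Θ : X × ℝ → Y}
    (hΘ : Continuous Θ) (h1 : ∀ x t, Θ (x, t + 1) = Θ (x, t)) :
    ∃ ψ : X × Circle → Y, Continuous ψ ∧ ∀ x t, ψ (x, turn t) = Θ (x, t) := by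
  have hq : IsQuotientMap
      (⟨Prod.map id turn, continuous_id.prodMap continuous_turn⟩ : C(X × ℝ, X × Circle)) :=
    (IsOpenMap.id.prodMap isOpenMap_turn).isQuotientMap (continuous_id.prodMap continuous_turn)
      (Function.surjective_id.prodMap turn_surjective)
  have hper : ∀ x (m : ℤ) t, Θ (x, t + m) = Θ (x, t) := fun x m t => by
    simpa using (show Function.Periodic (fun t => Θ (x, t)) 1 from h1 x).int_mul m t
  have hfac : Function.FactorsThrough Θ (Prod.map id turn : X × ℝ → X × Circle) := by
    rintro ⟨x, t⟩ ⟨x', t'⟩ h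
    obtain ⟨(rfl : x = x'), h2⟩ := Prod.ext_iff.1 h
    obtain ⟨m, rfl⟩ := turn_eq_iff.1 h2
    exact hper x m t'
  exact ⟨hq.lift ⟨Θ, hΘ⟩ hfac, ContinuousMap.continuous _,
    fun x t => DFunLike.congr_fun (hq.lift_comp ⟨Θ, hΘ⟩ hfac) (x, t)⟩

/-- A curve in a neighbourhood of `A₀` on which the angular coordinate has a real-valued branch
does not wind. -/
lemma not_isEssential_of_branch {A₀ : Set Annulus} (hc : IsClosed A₀) (ψ₀ : A₀ → ℝ)
    (hψ₀ : Continuous ψ₀) (h : ∀ x : A₀, turn (ψ₀ x) = x.1.2) : ¬ IsEssential A₀ := fun hess => by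
  obtain ⟨ψ, hψ⟩ := ContinuousMap.exists_extension hc.isClosedEmbedding_subtypeVal ⟨ψ₀, hψ₀⟩
  -- On `U` the angle is within a quarter turn of the extended branch `ψ` modulo full turns. Along a
  -- closed curve in `U` their difference varies by less than half a turn, so the winding number is
  -- `0`.
  set U : Set Annulus := {x | 0 < ((x.2 / turn (ψ x) : Circle) : ℂ).re}
  have hU : IsOpen U := isOpen_lt continuous_const (Complex.continuous_re.comp
    (continuous_subtype_val.comp (continuous_snd.div' (continuous_turn.comp ψ.continuous))))
  have hAU : A₀ ⊆ U := fun x hx => by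
    have h1 : ψ x = ψ₀ ⟨x, hx⟩ := DFunLike.congr_fun hψ ⟨x, hx⟩
    simp [U, h1, h]
  have h0 : {n : ℤ | ∃ γ : C(Circle, Annulus), range γ ⊆ U ∧ HasWindingNumber γ n} ⊆
      ((⊥ : AddSubgroup ℤ) : Set ℤ) := by
    rintro n ⟨γ, hγU, θ, hθ, hθγ, hθ1⟩
    set D : ℝ → ℝ := fun t => 2 * π * (θ t - ψ (γ (turn t)))
    have hD : Continuous D := by
      have := ψ.continuous.comp (γ.continuous.comp continuous_turn)
      exact continuous_const.mul (hθ.sub this)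
    have hcos : ∀ t, Real.cos (D t) ≠ 0 := fun t => by
      have h1 : 0 < (((γ (turn t)).2 / turn (ψ (γ (turn t))) : Circle) : ℂ).re :=
        hγU ⟨turn t, rfl⟩
      have h2 : (γ (turn t)).2 = turn (θ t) := hθγ t
      rw [h2, div_eq_mul_inv, ← turn_neg, ← turn_add, ← sub_eq_add_neg] at h1
      rw [turn, Circle.coe_exp, Complex.exp_ofReal_mul_I_re] at h1
      exact h1.ne'
    have h3 := abs_sub_lt_pi_of_cos_ne_zero hD hcos (0 + 1) 0
    have h4 : D (0 + 1) - D 0 = n * (2 * π) := by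
      simp only [D, turn_add_one, hθ1]
      ring
    rw [h4, abs_mul, abs_of_pos (by positivity : 0 < 2 * π)] at h3
    have h5 : |(n : ℝ)| < 1 := by
      by_contra! hcon
      nlinarith [pi_pos]
    rw [← Int.cast_abs] at h5
    exact Int.abs_lt_one_iff.1 (by exact_mod_cast h5)
  have h1 := (AddSubgroup.closure_le _).2 h0
  have h2 : AddSubgroup.closure _ = ⊤ := hess U hU hAU
  rw [h2] at h1
  have : (1 : ℤ) ∈ (⊥ : AddSubgroup ℤ) := h1 trivial
  simp at this

/-- A parametrization of a compact annulus in `A`, extended to all real values of the radial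
parameter. -/
structure IsAnnulusParam (G : ℝ × Circle → Annulus) (A₀ : Set Annulus) : Prop where
  continuous : Continuous G
  injOn : InjOn G (Icc 0 1 ×ˢ univ)
  image : G '' (Icc 0 1 ×ˢ univ) = A₀

/-- The circle of radial parameter `s`. -/
def IsAnnulusParam.circle {G : ℝ × Circle → Annulus} {A₀ : Set Annulus} (h : IsAnnulusParam G A₀)
    (s : ℝ) : C(Circle, Annulus) := ⟨fun w => G (s, w), h.continuous.comp (by fun_prop)⟩

/-- If the middle circle did not wind, the lifted angle would be periodic in `t` and would descend
to a real branch on `A₀`, contradicting essentiality. -/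
lemma exists_annulusParam {A₀ : Set Annulus} (e : A₀ ≃ₜ Icc (0 : ℝ) 1 × Circle)
    (hess : IsEssential A₀) : ∃ G, ∃ h : IsAnnulusParam G A₀,
      ∃ m : ℤ, m ≠ 0 ∧ HasWindingNumber (h.circle (1 / 2)) m := by
  set G : ℝ × Circle → Annulus := fun p => (e.symm (projIcc 0 1 zero_le_one p.1, p.2)).1 with hGdef
  have hcont : Continuous G := continuous_subtype_val.comp (e.symm.continuous.comp
    ((continuous_projIcc.comp continuous_fst).prodMk continuous_snd))
  have hG : ∀ (s : Icc (0 : ℝ) 1) w, G (s, w) = e.symm (s, w) := fun s w => by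
    simp only [G, projIcc_val]
  have h : IsAnnulusParam G A₀ := by
    refine ⟨hcont, ?_, ?_⟩
    · rintro ⟨s, w⟩ ⟨hs, -⟩ ⟨s', w'⟩ ⟨hs', -⟩ heq
      lift s to Icc (0 : ℝ) 1 using hs
      lift s' to Icc (0 : ℝ) 1 using hs'
      rw [hG, hG] at heq
      have := e.symm.injective (Subtype.ext heq)
      simp only [Prod.mk.injEq] at this ⊢
      exact ⟨congrArg _ this.1, this.2⟩
    · ext x
      constructor
      · rintro ⟨⟨s, w⟩, -, rfl⟩
        exact Subtype.property _
      · intro hx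
        refine ⟨((e ⟨x, hx⟩).1, (e ⟨x, hx⟩).2), ⟨(e ⟨x, hx⟩).1.2, trivial⟩, ?_⟩
        rw [hG]
        simp
  refine ⟨G, h, ?_⟩
  obtain ⟨Θ, hΘ, hΘG⟩ := exists_turn_lift (fun p : ℝ × ℝ => (G (p.1, turn p.2)).2)
    (continuous_snd.comp (hcont.comp (continuous_fst.prodMk (continuous_turn.comp continuous_snd))))
  obtain ⟨m, hm⟩ := exists_int_eq_of_turn_eq (θ := fun p : ℝ × ℝ => Θ (p.1, p.2 + 1)) (θ' := Θ)
    (by fun_prop) hΘ (fun p => by simp only [hΘG, turn_add_one])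
  refine ⟨m, ?_, fun t => Θ (1 / 2, t), by fun_prop, fun t => (hΘG (1 / 2, t)).symm,
    fun t => hm (1 / 2, t)⟩
  rintro rfl
  obtain ⟨ψ, hψ, hψΘ⟩ := exists_descent hΘ (fun s t => by simpa using hm (s, t))
  have hcomp : IsCompact A₀ := by
    rw [← h.image]
    exact (isCompact_Icc.prod isCompact_univ).image hcont
  refine not_isEssential_of_branch hcomp.isClosed (fun x => ψ ((e x).1, (e x).2))
    (hψ.comp (by fun_prop)) (fun x => ?_) hess
  obtain ⟨t, ht⟩ := turn_surjective (e x).2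
  rw [← ht, hψΘ, hΘG]
  simp only [hG, ht]
  simp

namespace IsAnnulusParam

variable {G : ℝ × Circle → Annulus} {A₀ : Set Annulus}

/-- The open annulus bounded by the two boundary circles. -/
def core (_ : IsAnnulusParam G A₀) : Set Annulus := G '' (Ioo 0 1 ×ˢ univ)

lemma core_subset (h : IsAnnulusParam G A₀) : h.core ⊆ A₀ := by
  refine Subset.trans ?_ h.image.subset
  exact image_mono (prod_mono Ioo_subset_Icc_self subset_rfl)

lemma subset_closure_core (h : IsAnnulusParam G A₀) : A₀ ⊆ closure h.core := by
  refine h.image.symm.subset.trans ?_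
  rw [← closure_Ioo (zero_ne_one (α := ℝ)), ← closure_univ (X := Circle), ← closure_prod_eq]
  exact (image_closure_subset_closure_image h.continuous).trans (by simp [core])

lemma isCompact (h : IsAnnulusParam G A₀) : IsCompact A₀ := by
  rw [← h.image]
  exact (isCompact_Icc.prod isCompact_univ).image h.continuous

lemma isPreconnected_image (h : IsAnnulusParam G A₀) {S : Set ℝ} (hS : IsPreconnected S) :
    IsPreconnected (G '' (S ×ˢ univ)) :=
  (hS.prod isPreconnected_univ).image _ h.continuous.continuousOn

lemma isPreconnected (h : IsAnnulusParam G A₀) : IsPreconnected A₀ := by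
  have := h.isPreconnected_image (isPreconnected_Icc (a := 0) (b := 1))
  rwa [h.image] at this

/-- Invariance of domain, applied to `G` on a small disc of parameters and read in the coordinates
of the strip. -/
lemma isOpen_core (h : IsAnnulusParam G A₀) : IsOpen h.core := by
  rw [isOpen_iff_mem_nhds]
  rintro _ ⟨⟨s₀, w⟩, ⟨⟨hs0, hs1⟩, -⟩, rfl⟩
  obtain ⟨t₀, rfl⟩ := turn_surjective w
  obtain ⟨Θ, hΘ, hΘG⟩ := exists_turn_lift (fun p : ℝ × ℝ => (G (p.1, turn p.2)).2)
    (continuous_snd.comp (h.continuous.comp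
      (continuous_fst.prodMk (continuous_turn.comp continuous_snd))))
  -- The first two bounds keep the radial parameter in `(0, 1)`; the third makes `turn` injective on
  -- the disc.
  obtain ⟨κ, hκ, hκ0, hκ1, hκ2⟩ : ∃ κ > 0, κ < s₀ ∧ κ < 1 - s₀ ∧ κ < 1 / 2 := by
    refine ⟨min s₀ (1 - s₀) / 2, ?_, ?_, ?_, ?_⟩
    all_goals rcases min_cases s₀ (1 - s₀) with ⟨h1, h2⟩ | ⟨h1, h2⟩ <;> rw [h1] <;> linarith
  set S : ℂ → ℝ := fun ζ => s₀ + κ * ζ.re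
  set T : ℂ → ℝ := fun ζ => t₀ + κ * ζ.im
  set e : ℂ → ℂ := fun ζ =>
    ((G (S ζ, turn (T ζ))).1 : ℝ) + (Θ (S ζ, T ζ) : ℂ) * Complex.I with he_def
  have hST : Continuous fun ζ => (S ζ, T ζ) := by fun_prop
  have hG : Continuous fun ζ => G (S ζ, turn (T ζ)) :=
    h.continuous.comp (hST.fst.prodMk (continuous_turn.comp hST.snd))
  have he : Continuous e :=
    (Complex.continuous_ofReal.comp (continuous_subtype_val.comp hG.fst)).add
      ((Complex.continuous_ofReal.comp (hΘ.comp hST)).mul continuous_const)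
  have hball : ∀ ζ ∈ Metric.closedBall (0 : ℂ) 1, S ζ ∈ Ioo 0 1 ∧ |T ζ - t₀| < 1 / 2 :=
    fun ζ hζ => by
      rw [mem_closedBall_zero_iff] at hζ
      have h1 := abs_le.1 ((Complex.abs_re_le_norm ζ).trans hζ)
      have h2 := abs_le.1 ((Complex.abs_im_le_norm ζ).trans hζ)
      refine ⟨⟨?_, ?_⟩, abs_lt.2 ⟨?_, ?_⟩⟩ <;> simp only [S, T] <;> nlinarith
  have hre : ∀ ζ, (e ζ).re = (G (S ζ, turn (T ζ))).1 := fun ζ => by simp [he_def]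
  have him : ∀ ζ, (e ζ).im = Θ (S ζ, T ζ) := fun ζ => by simp [he_def]
  have hproj : ∀ ζ, proj ((G (S ζ, turn (T ζ))).1, Θ (S ζ, T ζ)) = G (S ζ, turn (T ζ)) :=
    fun ζ => Prod.ext rfl (hΘG _)
  have hinj : InjOn e (Metric.closedBall 0 1) := fun ζ hζ ζ' hζ' heq => by
    have h1 : G (S ζ, turn (T ζ)) = G (S ζ', turn (T ζ')) := by
      refine (hproj ζ).symm.trans (Eq.trans (congrArg proj ?_) (hproj ζ'))
      refine Prod.ext (Subtype.ext ?_) ?_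
      · exact (hre ζ).symm.trans ((congrArg Complex.re heq).trans (hre ζ'))
      · exact (him ζ).symm.trans ((congrArg Complex.im heq).trans (him ζ'))
    have h2 := h.injOn ⟨Ioo_subset_Icc_self (hball ζ hζ).1, trivial⟩
      ⟨Ioo_subset_Icc_self (hball ζ' hζ').1, trivial⟩ h1
    obtain ⟨h3, h4⟩ := Prod.ext_iff.1 h2
    obtain ⟨m, hm⟩ := turn_eq_iff.1 h4
    have h5 : |(m : ℝ)| < 1 := by
      have a1 := abs_lt.1 (hball ζ hζ).2
      have a2 := abs_lt.1 (hball ζ' hζ').2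
      rw [abs_lt]
      constructor <;> linarith
    rw [← Int.cast_abs] at h5
    have h6 : m = 0 := Int.abs_lt_one_iff.1 (by exact_mod_cast h5)
    simp only [h6, Int.cast_zero, add_zero] at hm
    refine Complex.ext (mul_left_cancel₀ hκ.ne' ?_) (mul_left_cancel₀ hκ.ne' ?_)
    · simpa [S] using h3
    · simpa [T] using hm
  have hnhds := image_closedBall_mem_nhds he hinj
  set p₀ : Strip := ((G (S 0, turn (T 0))).1, Θ (S 0, T 0))
  have hc : Continuous fun p : Strip => ((p.1 : ℝ) : ℂ) + (p.2 : ℂ) * Complex.I := by fun_prop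
  have h7 := isOpenMap_proj.image_mem_nhds (hc.continuousAt (x := p₀) hnhds)
  rw [hproj 0] at h7
  have h8 : G (S 0, turn (T 0)) = G (s₀, turn t₀) := by simp [S, T]
  rw [h8] at h7
  refine Filter.mem_of_superset h7 ?_
  rintro _ ⟨p, ⟨ζ, hζ, hp⟩, rfl⟩
  refine ⟨(S ζ, turn (T ζ)), ⟨(hball ζ hζ).1, trivial⟩, ?_⟩
  rw [← hproj]
  congr 1
  refine Prod.ext (Subtype.ext ?_) ?_
  · simpa [he_def] using congrArg Complex.re hp
  · simpa [he_def] using congrArg Complex.im hp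

end IsAnnulusParam

/-! ### The two sides of the middle circle -/

lemma isPreconnected_subset_component {X : Type*} [TopologicalSpace X] {S F : Set X}
    {x : X} (hS : IsPreconnected S) (hSF : S ⊆ F) (h : (S ∩ connectedComponentIn F x).Nonempty) :
    S ⊆ connectedComponentIn F x := by
  obtain ⟨y, hyS, hyx⟩ := h
  rw [connectedComponentIn_eq hyx]
  exact hS.subset_connectedComponentIn hyS hSF

lemma isPreconnected_radial {S : Set ℝ} (hS : S.OrdConnected) :
    IsPreconnected (Subtype.val ⁻¹' S : Set (Ioo (0 : ℝ) 1)) := by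
  rw [← IsInducing.subtypeVal.isPreconnected_image, Subtype.image_preimage_coe]
  exact (ordConnected_Ioo.inter hS).isPreconnected

/-- The two sides of an essential circle in the core of an embedded annulus: `W₀` contains the end
`0` of `A`, and `W₁` the end `1`. -/
structure IsSeparation (K O W₀ W₁ : Set Annulus) : Prop where
  isOpen₀ : IsOpen W₀
  isOpen₁ : IsOpen W₁
  disjoint : Disjoint W₀ W₁
  union : W₀ ∪ W₁ = Kᶜ
  preconnected₀ : IsPreconnected (W₀ ∪ O)
  preconnected₁ : IsPreconnected (W₁ ∪ O)
  ends : ∃ ε : ℝ, 0 < ε ∧ ε < 1 ∧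
    (∀ x : Annulus, (x.1 : ℝ) < ε → x ∈ W₀) ∧ ∀ x : Annulus, 1 - ε < (x.1 : ℝ) → x ∈ W₁

namespace IsAnnulusParam

variable {G : ℝ × Circle → Annulus} {A₀ : Set Annulus}

/-- A component of `Kᶜ` that missed the open core, a neighbourhood of `K`, would be clopen in the
connected annulus. So it meets the core off `K` and contains one of its two halves; there are at
most two components. -/
lemma core_subset_component (h : IsAnnulusParam G A₀) {x : Annulus}
    (hx : x ∉ range (h.circle (1 / 2))) :
    G '' (Ioo 0 (1 / 2) ×ˢ univ) ⊆ connectedComponentIn (range (h.circle (1 / 2)))ᶜ x ∨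
    G '' (Ioo (1 / 2) 1 ×ˢ univ) ⊆ connectedComponentIn (range (h.circle (1 / 2)))ᶜ x := by
  set K := range (h.circle (1 / 2)) with hK
  set D := connectedComponentIn Kᶜ x
  have hKc : IsClosed K := (isCompact_range (h.circle (1 / 2)).continuous).isClosed
  have hDo : IsOpen D := hKc.isOpen_compl.connectedComponentIn
  have hKO : K ⊆ h.core := by
    rintro _ ⟨w, rfl⟩
    exact ⟨(1 / 2, w), ⟨by norm_num, trivial⟩, rfl⟩
  have hS : ∀ S : Set ℝ, S ⊆ Icc 0 1 → (1 / 2) ∉ S → G '' (S ×ˢ univ) ⊆ Kᶜ := by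
    rintro S hS hn _ ⟨⟨s, w⟩, ⟨hs, -⟩, rfl⟩ ⟨w', hw⟩
    have h1 := h.injOn (x₁ := (1 / 2, w')) (x₂ := (s, w)) ⟨by norm_num, trivial⟩
      ⟨hS hs, trivial⟩ hw
    have h2 : 1 / 2 = s := (Prod.ext_iff.1 h1).1
    exact hn (h2 ▸ hs)
  have hne : (D ∩ h.core).Nonempty := by
    by_contra hcon
    rw [not_nonempty_iff_eq_empty] at hcon
    have hcl : IsClosed D := by
      refine isClosed_of_closure_subset fun y hy => ?_
      by_cases hyK : y ∈ K
      · obtain ⟨z, hz⟩ := mem_closure_iff.1 hy h.core h.isOpen_core (hKO hyK)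
        exact absurd hz (by rw [inter_comm, hcon]; exact notMem_empty z)
      · obtain ⟨z, hz1, hz2⟩ := mem_closure_iff.1 hy (connectedComponentIn Kᶜ y)
          hKc.isOpen_compl.connectedComponentIn (mem_connectedComponentIn hyK)
        rw [show D = connectedComponentIn Kᶜ z from connectedComponentIn_eq hz2,
          ← connectedComponentIn_eq hz1]
        exact mem_connectedComponentIn hyK
    have huniv := IsClopen.eq_univ ⟨hcl, hDo⟩ ⟨x, mem_connectedComponentIn hx⟩
    have hmem : h.circle (1 / 2) 1 ∈ D := huniv ▸ mem_univ _
    exact connectedComponentIn_subset _ _ hmem ⟨1, rfl⟩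
  obtain ⟨_, hyD, ⟨s, w⟩, ⟨⟨hs0, hs1⟩, -⟩, rfl⟩ := hne
  rcases lt_trichotomy s (1 / 2) with hlt | rfl | hgt
  · left
    refine isPreconnected_subset_component (h.isPreconnected_image isPreconnected_Ioo)
      (hS _ (fun y hy => ⟨hy.1.le, by linarith [hy.2]⟩) (by simp))
      ⟨_, ⟨(s, w), ⟨⟨hs0, hlt⟩, trivial⟩, rfl⟩, hyD⟩
  · exact absurd ⟨w, rfl⟩ (connectedComponentIn_subset _ _ hyD)
  · right
    refine isPreconnected_subset_component (h.isPreconnected_image isPreconnected_Ioo)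
      (hS _ (fun y hy => ⟨by linarith [hy.1], hy.2.le⟩) (by simp))
      ⟨_, ⟨(s, w), ⟨⟨hgt, hs1⟩, trivial⟩, rfl⟩, hyD⟩

/-- The components of the two ends differ because a path joining them would meet the essential
circle. Each contains a half of the core, so they take one half each and leave no room for a third
component. -/
lemma exists_separation (h : IsAnnulusParam G A₀) {m : ℤ} (hm : m ≠ 0)
    (hwind : HasWindingNumber (h.circle (1 / 2)) m) :
    ∃ W₀ W₁, IsSeparation (range (h.circle (1 / 2))) h.core W₀ W₁ := by
  set K := range (h.circle (1 / 2)) with hK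
  have hKc : IsClosed K := (isCompact_range (h.circle (1 / 2)).continuous).isClosed
  obtain ⟨ε, hε0, hε1, hεK⟩ : ∃ ε : ℝ, 0 < ε ∧ ε < 1 / 2 ∧
      ∀ x ∈ K, ε < (x.1 : ℝ) ∧ (x.1 : ℝ) < 1 - ε := by
    have hf : Continuous fun x : Annulus => min (x.1 : ℝ) (1 - x.1) := by fun_prop
    obtain ⟨x₀, hx₀, hmin⟩ := (isCompact_range (h.circle (1 / 2)).continuous).exists_isMinOn
      (range_nonempty _) hf.continuousOn
    have hpos : 0 < min (x₀.1 : ℝ) (1 - x₀.1) :=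
      lt_min x₀.1.2.1 (by linarith [x₀.1.2.2])
    refine ⟨min (x₀.1 : ℝ) (1 - x₀.1) / 2, by linarith, ?_, fun x hx => ?_⟩
    · have h1 := min_le_left (x₀.1 : ℝ) (1 - x₀.1)
      have h2 := min_le_right (x₀.1 : ℝ) (1 - x₀.1)
      linarith
    · have h1 : min (x₀.1 : ℝ) (1 - x₀.1) ≤ min (x.1 : ℝ) (1 - x.1) := hmin hx
      have h2 := le_min_iff.1 h1
      constructor <;> linarith
  set E₀ : Set Annulus := (Subtype.val ⁻¹' Iio ε) ×ˢ univ
  set E₁ : Set Annulus := (Subtype.val ⁻¹' Ioi (1 - ε)) ×ˢ univ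
  have hE₀c : IsPreconnected E₀ := (isPreconnected_radial ordConnected_Iio).prod isPreconnected_univ
  have hE₁c : IsPreconnected E₁ := (isPreconnected_radial ordConnected_Ioi).prod isPreconnected_univ
  have hE₀K : E₀ ⊆ Kᶜ := fun x hx hxK => by
    have h1 : (x.1 : ℝ) < ε := hx.1
    linarith [(hεK x hxK).1]
  have hE₁K : E₁ ⊆ Kᶜ := fun x hx hxK => by
    have h1 : 1 - ε < (x.1 : ℝ) := hx.1
    linarith [(hεK x hxK).2]
  set x₀ : Annulus := (⟨ε / 2, by linarith, by linarith⟩, 1)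
  set x₁ : Annulus := (⟨1 - ε / 2, by linarith, by linarith⟩, 1)
  have hx₀ : x₀ ∈ E₀ := ⟨show ε / 2 < ε by linarith, trivial⟩
  have hx₁ : x₁ ∈ E₁ := ⟨show 1 - ε < 1 - ε / 2 by linarith, trivial⟩
  set W₀ := connectedComponentIn Kᶜ x₀
  set W₁ := connectedComponentIn Kᶜ x₁
  have hW₀o : IsOpen W₀ := hKc.isOpen_compl.connectedComponentIn
  have hW₁o : IsOpen W₁ := hKc.isOpen_compl.connectedComponentIn
  have hne : x₁ ∉ W₀ := fun hmem => by
    have hconn : IsConnected W₀ := isConnected_connectedComponentIn_iff.2 (hE₀K hx₀)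
    obtain ⟨p, hp⟩ := (hW₀o.isConnected_iff_isPathConnected.1 hconn).joinedIn x₀
      (mem_connectedComponentIn (hE₀K hx₀)) x₁ hmem
    obtain ⟨s, hs⟩ := path_meets_of_winding_ne_zero hm hwind p
      (fun w => by linarith [(hεK _ ⟨w, rfl⟩).1, show (x₀.1 : ℝ) = ε / 2 from rfl])
      (fun w => by linarith [(hεK _ ⟨w, rfl⟩).2, show (x₁.1 : ℝ) = 1 - ε / 2 from rfl])
    exact connectedComponentIn_subset _ _ (hp s) hs
  have hdisj : Disjoint W₀ W₁ := by
    rw [Set.disjoint_left]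
    intro y hy0 hy1
    apply hne
    rw [show W₀ = connectedComponentIn Kᶜ y from connectedComponentIn_eq hy0,
      ← connectedComponentIn_eq hy1]
    exact mem_connectedComponentIn (hE₁K hx₁)
  set O₀ := G '' (Ioo 0 (1 / 2) ×ˢ univ)
  set O₁ := G '' (Ioo (1 / 2) 1 ×ˢ univ)
  have hO₀ : O₀.Nonempty := ⟨_, (1 / 4, 1), ⟨by norm_num, trivial⟩, rfl⟩
  have hO₁ : O₁.Nonempty := ⟨_, (3 / 4, 1), ⟨by norm_num, trivial⟩, rfl⟩
  have hO₀O : O₀ ⊆ h.core :=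
    image_mono (prod_mono (Ioo_subset_Ioo_right (by norm_num)) subset_rfl)
  have hO₁O : O₁ ⊆ h.core :=
    image_mono (prod_mono (Ioo_subset_Ioo_left (by norm_num)) subset_rfl)
  have hshare : ∀ {x y : Annulus} {S : Set Annulus}, S.Nonempty →
      S ⊆ connectedComponentIn Kᶜ x → S ⊆ connectedComponentIn Kᶜ y →
      connectedComponentIn Kᶜ x = connectedComponentIn Kᶜ y := by
    rintro x y S ⟨z, hz⟩ h1 h2
    rw [connectedComponentIn_eq (h1 hz), connectedComponentIn_eq (h2 hz)]
  have h01 : W₀ ≠ W₁ := fun heq => hne (heq ▸ mem_connectedComponentIn (hE₁K hx₁))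
  have c₀ : O₀ ⊆ W₀ ∨ O₁ ⊆ W₀ := h.core_subset_component (hE₀K hx₀)
  have c₁ : O₀ ⊆ W₁ ∨ O₁ ⊆ W₁ := h.core_subset_component (hE₁K hx₁)
  have hcore : IsPreconnected h.core := h.isPreconnected_image isPreconnected_Ioo
  have hpre : ∀ x, (O₀ ⊆ connectedComponentIn Kᶜ x ∨ O₁ ⊆ connectedComponentIn Kᶜ x) →
      IsPreconnected (connectedComponentIn Kᶜ x ∪ h.core) := fun x hx => by
    obtain ⟨z, hz1, hz2⟩ : (connectedComponentIn Kᶜ x ∩ h.core).Nonempty := by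
      rcases hx with hx | hx
      · exact hO₀.mono (subset_inter hx hO₀O)
      · exact hO₁.mono (subset_inter hx hO₁O)
    exact isPreconnected_connectedComponentIn.union z hz1 hz2 hcore
  refine ⟨W₀, W₁, hW₀o, hW₁o, hdisj, ?_, hpre _ c₀, hpre _ c₁, ε, hε0, by linarith,
    fun x hx => ?_, fun x hx => ?_⟩
  · refine Subset.antisymm (union_subset (connectedComponentIn_subset _ _)
      (connectedComponentIn_subset _ _)) fun x hx => ?_
    have hxx := mem_connectedComponentIn (F := Kᶜ) hx
    have hdec : connectedComponentIn Kᶜ x = W₀ ∨ connectedComponentIn Kᶜ x = W₁ := by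
      rcases h.core_subset_component hx with hx0 | hx0 <;> rcases c₀ with c₀ | c₀ <;>
        rcases c₁ with c₁ | c₁
      · exact .inl (hshare hO₀ hx0 c₀)
      · exact .inl (hshare hO₀ hx0 c₀)
      · exact .inr (hshare hO₀ hx0 c₁)
      · exact absurd (hshare hO₁ c₀ c₁) h01
      · exact absurd (hshare hO₀ c₀ c₁) h01
      · exact .inr (hshare hO₁ hx0 c₁)
      · exact .inl (hshare hO₁ hx0 c₀)
      · exact .inl (hshare hO₁ hx0 c₀)
    rcases hdec with hd | hd
    · exact .inl (hd ▸ hxx)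
    · exact .inr (hd ▸ hxx)
  · exact hE₀c.subset_connectedComponentIn hx₀ hE₀K ⟨hx, trivial⟩
  · exact hE₁c.subset_connectedComponentIn hx₁ hE₁K ⟨hx, trivial⟩

end IsAnnulusParam

/-! ### Lifting coverings of the annulus to the strip -/

lemma exists_proj_lift {X : Type*} [TopologicalSpace X] [SimplyConnectedSpace X]
    [LocallyPathConnectedSpace X] (g : X → Annulus) (hg : Continuous g) :
    ∃ F : X → Strip, Continuous F ∧ ∀ x, proj (F x) = g x := by
  obtain ⟨θ, hθ, h⟩ := exists_turn_lift (fun x => (g x).2) hg.snd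
  exact ⟨fun x => ((g x).1, θ x), hg.fst.prodMk hθ, fun x => Prod.ext rfl (h x)⟩

lemma exists_deck_of_proj_eq {X : Type*} [TopologicalSpace X] [PreconnectedSpace X] [Nonempty X]
    {F F' : X → Strip} (hF : Continuous F) (hF' : Continuous F')
    (h : ∀ x, proj (F x) = proj (F' x)) : ∃ m : ℤ, ∀ x, F x = deck m (F' x) := by
  obtain ⟨m, hm⟩ := exists_int_eq_of_turn_eq hF.snd hF'.snd (fun x => (Prod.ext_iff.1 (h x)).2)
  exact ⟨m, fun x => Prod.ext (Prod.ext_iff.1 (h x)).1 (hm x)⟩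

/-- The homeomorphism `F` of the strip is a lift of the self-map `f` of degree `d`. -/
structure IsStripLift (f : Annulus → Annulus) (d : ℤ) (F : Strip ≃ₜ Strip) : Prop where
  proj_apply : ∀ p, proj (F p) = f (proj p)
  apply_deck : ∀ m p, F (deck m p) = deck (d * m) (F p)

lemma apply_deck_of_apply_deck_one {F : Strip → Strip} {d : ℤ}
    (h : ∀ p, F (deck 1 p) = deck d (F p)) (m : ℤ) (p : Strip) :
    F (deck m p) = deck (d * m) (F p) := by
  induction m generalizing p with
  | zero => simp
  | succ i ih => rw [add_comm, ← deck_deck, ih, h, deck_deck]; congr 1; ring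
  | pred i ih =>
    have h1 := h (deck (-(i : ℤ) - 1) p)
    rw [deck_deck, sub_add_cancel, ih] at h1
    have h2 := congrArg (deck (-d)) h1
    rw [deck_deck, deck_deck, add_neg_cancel, deck_zero] at h2
    rw [← h2]
    congr 1
    ring

/-- A covering of the annulus of degree `d` lifts to a homeomorphism of the strip. -/
lemma exists_stripLift {f : C(Annulus, Annulus)} (hf : IsCoveringMap f) {d : ℤ}
    (hdeg : HasDegree f d) : ∃ F : Strip ≃ₜ Strip, IsStripLift f d F := by
  obtain ⟨F, hF, hFp⟩ := exists_proj_lift (fun p : Strip => f (proj p))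
    (f.continuous.comp continuous_proj)
  obtain ⟨p₀⟩ : Nonempty Strip := inferInstance
  -- Lifting `proj` through `f`, and the result through `proj`, gives an inverse of `F` up to deck
  -- transformations.
  obtain ⟨π', ⟨h0, hπ'⟩, -⟩ := hf.existsUnique_continuousMap_lifts ⟨proj, continuous_proj⟩ (F p₀)
    (proj p₀) (hFp p₀).symm
  have hfπ' : ∀ p, f (π' p) = proj p := fun p => congrFun hπ' p
  obtain ⟨H, hH, hHp⟩ := exists_proj_lift π' π'.continuous
  obtain ⟨j, hj⟩ := exists_deck_of_proj_eq (F := fun p => F (H p)) (F' := id)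
    (hF.comp hH) continuous_id (fun p => by rw [hFp, hHp, hfπ']; rfl)
  obtain ⟨i, hi⟩ := exists_deck_of_proj_eq (F := fun p => H (F p)) (F' := id)
    (hH.comp hF) continuous_id (fun p => by
      have := hf.eq_of_comp_eq (g₁ := fun p => proj (H (F p))) (g₂ := proj)
        (continuous_proj.comp (hH.comp hF)) continuous_proj
        (funext fun p => by simp only [Function.comp]; rw [hHp, hfπ', hFp]) p₀
        (by rw [hHp, h0])
      exact congrFun this p)
  simp only [id] at hi hj
  let Φ : Strip ≃ₜ Strip :=
    { toFun := F
      invFun := fun p => deck (-i) (H p)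
      left_inv := fun p => by simp only [hi, deck_deck, add_neg_cancel, deck_zero]
      right_inv := fun p => by
        have h1 : ∀ q, deck (-i) (H (F q)) = q := fun q => by
          simp only [hi, deck_deck, add_neg_cancel, deck_zero]
        have h2 : p = F (H (deck (-j) p)) := by
          rw [hj, deck_deck, neg_add_cancel, deck_zero]
        change F (deck (-i) (H p)) = p
        rw [h2, h1]
      continuous_toFun := hF
      continuous_invFun := (continuous_deck _).comp hH }
  refine ⟨Φ, hFp, apply_deck_of_apply_deck_one fun p => ?_⟩
  change F (deck 1 p) = deck d (F p)
  obtain ⟨k, hk⟩ := exists_deck_of_proj_eq (F := fun p => F (deck 1 p)) (F' := F)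
    (hF.comp (continuous_deck 1)) hF (fun p => by rw [hFp, hFp, proj_deck])
  -- The degree is read off on the circle of radius `1 / 2`, which has winding number `1`.
  have hkd : k = d := by
    set r : Ioo (0 : ℝ) 1 := ⟨1 / 2, by norm_num⟩
    obtain ⟨θ, hθ, hθf, hθ1⟩ := hdeg ⟨fun w => (r, w), by fun_prop⟩ 1
      ⟨id, continuous_id, fun t => rfl, fun t => by simp⟩
    obtain ⟨c, hc⟩ := exists_int_eq_of_turn_eq (θ := θ) (θ' := fun t => (F (r, t)).2) hθ
      (hF.comp (by fun_prop : Continuous fun t : ℝ => ((r, t) : Strip))).snd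
      (fun t => (hθf t).symm.trans (Prod.ext_iff.1 (hFp (r, t))).2.symm)
    have h1 := hθ1 0
    have h2 : (F (r, 0 + 1)).2 = (F (r, 0)).2 + k := by
      simpa [deck] using (Prod.ext_iff.1 (hk (r, 0))).2
    rw [hc, hc, h2] at h1
    have h3 : (k : ℝ) = ((d * 1 : ℤ) : ℝ) := by linarith
    have := Int.cast_injective h3
    omega
  rw [hk, hkd]

namespace IsStripLift

variable {f : Annulus → Annulus} {d : ℤ} {F : Strip ≃ₜ Strip}

lemma symm_apply_deck (hF : IsStripLift f d F) (m : ℤ) (p : Strip) :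
    F.symm (deck (d * m) p) = deck m (F.symm p) := by
  rw [Homeomorph.symm_apply_eq, hF.apply_deck, F.apply_symm_apply]

lemma proj_symm_apply (hF : IsStripLift f d F) (p : Strip) : f (proj (F.symm p)) = proj p := by
  rw [← hF.proj_apply, F.apply_symm_apply]

lemma surjective (hF : IsStripLift f d F) : Function.Surjective f := fun x => by
  obtain ⟨p, rfl⟩ := proj_surjective x
  exact ⟨_, hF.proj_symm_apply p⟩

end IsStripLift

/-! ### A fixed point of coverings that interchange the ends -/

/-- **Poincaré–Miranda theorem** in the plane. -/
lemma exists_zero_of_signs {X Y : ℝ × ℝ → ℝ} (hX : Continuous X) (hY : Continuous Y)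
    (hX0 : ∀ t ∈ Icc (0 : ℝ) 1, 0 < X (0, t)) (hX1 : ∀ t ∈ Icc (0 : ℝ) 1, X (1, t) < 0)
    (hY0 : ∀ s ∈ Icc (0 : ℝ) 1, Y (s, 0) < 0) (hY1 : ∀ s ∈ Icc (0 : ℝ) 1, 0 < Y (s, 1)) :
    ∃ p, X p = 0 ∧ Y p = 0 := by
  by_contra! hcon
  have hcl : Continuous fun p : ℝ × ℝ => (clamp p.1, clamp p.2) :=
    (continuous_clamp.comp continuous_fst).prodMk (continuous_clamp.comp continuous_snd)
  set c : ℝ × ℝ → ℝ × ℝ := fun p => (clamp p.1, clamp p.2) with hc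
  obtain ⟨L, hL, hexp⟩ := exists_log_lift (fun p => (X (c p) : ℂ) + Y (c p) * Complex.I)
    (by fun_prop) (fun p h => hcon (c p) (by simpa using congrArg Complex.re h)
      (by simpa using congrArg Complex.im h))
  set α : ℝ × ℝ → ℝ := fun p => (L p).im
  have hα : Continuous α := Complex.continuous_im.comp hL
  have hXc : ∀ p, X (c p) = Real.exp (L p).re * Real.cos (α p) := fun p => by
    have := congrArg Complex.re (hexp p)
    rw [Complex.exp_re] at this
    simpa using this.symm
  have hYs : ∀ p, Y (c p) = Real.exp (L p).re * Real.sin (α p) := fun p => by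
    have := congrArg Complex.im (hexp p)
    rw [Complex.exp_im] at this
    simpa using this.symm
  have c0 : clamp 0 = 0 := clamp_of_mem le_rfl zero_le_one
  have c1 : clamp 1 = 1 := clamp_of_mem zero_le_one le_rfl
  have hcm : ∀ t, clamp t ∈ Icc (0 : ℝ) 1 := fun t => ⟨clamp_nonneg t, clamp_le_one t⟩
  have l : ∀ t, 0 < Real.cos (α (0, t)) := fun t => by
    have := hXc (0, t)
    simp only [hc, c0] at this
    exact pos_of_mul_pos_right (this ▸ hX0 _ (hcm t)) (Real.exp_pos _).le
  have r : ∀ t, Real.cos (α (1, t)) < 0 := fun t => by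
    have := hXc (1, t)
    simp only [hc, c1] at this
    exact neg_of_mul_neg_right (this ▸ hX1 _ (hcm t)) (Real.exp_pos _).le
  have b : ∀ s, Real.sin (α (s, 0)) < 0 := fun t => by
    have := hYs (t, 0)
    simp only [hc, c0] at this
    exact neg_of_mul_neg_right (this ▸ hY0 _ (hcm t)) (Real.exp_pos _).le
  have u : ∀ s, 0 < Real.sin (α (s, 1)) := fun t => by
    have := hYs (t, 1)
    simp only [hc, c1] at this
    exact pos_of_mul_pos_right (this ▸ hY1 _ (hcm t)) (Real.exp_pos _).le
  have hs : ∀ {D : ℝ → ℝ}, Continuous D → (∀ t, Real.sin (D t) ≠ 0) → ∀ x y, |D x - D y| < π :=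
    fun {D} hD h x y => by
      have := abs_sub_lt_pi_of_cos_ne_zero (D := fun t => D t - π / 2) (by fun_prop)
        (fun t => by rw [Real.cos_sub_pi_div_two]; exact h t) x y
      simpa using this
  have hpos : ∀ {x y : ℝ}, |x - y| < π →
      0 < Real.sin x * Real.cos y - Real.cos x * Real.sin y → 0 < x - y := fun {x y} h1 h2 => by
    rw [← Real.sin_sub] at h2
    by_contra! h3
    exact h2.not_ge (Real.sin_nonpos_of_nonpos_of_neg_pi_le h3 (abs_lt.1 h1).1.le)
  -- Along each side of the square one of `cos α`, `sin α` keeps its sign, so `α` changes by less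
  -- than `π` there; the signs at the corners make all four changes positive in circular order, but
  -- they add up to `0`.
  have d1 := hpos (abs_sub_lt_pi_of_cos_ne_zero (D := fun t => α (0, t)) (by fun_prop)
    (fun t => (l t).ne') 1 0) (by nlinarith [l 0, l 1, b 0, u 0])
  have d2 := hpos (hs (D := fun s => α (s, 1)) (by fun_prop)
    (fun t => (u t).ne') 1 0) (by nlinarith [l 1, r 1, u 0, u 1])
  have d3 := hpos (abs_sub_lt_pi_of_cos_ne_zero (D := fun t => α (1, t)) (by fun_prop)
    (fun t => (r t).ne) 0 1) (by nlinarith [r 0, r 1, b 1, u 1])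
  have d4 := hpos (hs (D := fun s => α (s, 0)) (by fun_prop)
    (fun t => (b t).ne) 0 1) (by nlinarith [l 0, r 0, b 0, b 1])
  linarith

/-- Poincaré–Miranda on a rectangle of angular range `[-N, N]`. The radial displacement has opposite
signs at `r₀` and `r₁`. The angular one grows by `d - 1 ≠ 0` per deck transformation, so it has
opposite signs at `±N` for large `N`; `σ` is the sign of `d - 1`. -/
lemma exists_fixedPoint_of_radii {F : Strip → Strip} (hF : Continuous F) {d : ℤ} (hd : 1 < |d|)
    (hdeck : ∀ m p, F (deck m p) = deck (d * m) (F p)) {r₀ r₁ : Ioo (0 : ℝ) 1}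
    (h₀ : ∀ y, (r₀ : ℝ) < (F (r₀, y)).1) (h₁ : ∀ y, ((F (r₁, y)).1 : ℝ) < r₁) :
    ∃ p, F p = p := by
  set r : ℝ → Ioo (0 : ℝ) 1 := fun s => ⟨AffineMap.lineMap (r₀ : ℝ) r₁ (clamp s),
    (convex_Ioo 0 1).lineMap_mem r₀.2 r₁.2 ⟨clamp_nonneg s, clamp_le_one s⟩⟩
  have hr : Continuous r := by
    refine Continuous.subtype_mk ?_ _
    exact AffineMap.lineMap_continuous.comp continuous_clamp
  have hr0 : r 0 = r₀ := Subtype.ext (by simp [r, clamp_of_mem])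
  have hr1 : r 1 = r₁ := Subtype.ext (by simp [r, clamp_of_mem])
  set P : ℝ × ℝ → Strip := fun p => (r p.1, p.2)
  have hP : Continuous P := (hr.comp continuous_fst).prodMk continuous_snd
  set Y : ℝ × ℝ → ℝ := fun p => (F (P p)).2 - p.2
  have hY : Continuous Y := (hF.comp hP).snd.sub continuous_snd
  obtain ⟨B, hB⟩ : ∃ B, ∀ s ∈ Icc (0 : ℝ) 1, |Y (s, 0)| ≤ B := by
    obtain ⟨B, hB⟩ := (isCompact_Icc (a := (0 : ℝ)) (b := 1)).exists_bound_of_continuousOn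
      (f := fun s => Y (s, 0)) (by fun_prop)
    exact ⟨B, hB⟩
  obtain ⟨N, hN⟩ := exists_nat_gt B
  have hYm : ∀ s (m : ℤ), Y (s, m) = Y (s, 0) + (d - 1) * m := fun s m => by
    have h1 : P (s, (m : ℝ)) = deck m (P (s, 0)) := by simp [P, deck]
    simp only [Y, h1, hdeck]
    simp only [deck, P]
    push_cast
    ring
  have hXc : Continuous fun p : ℝ × ℝ => ((F (P (p.1, -N + 2 * N * p.2))).1 : ℝ) - r p.1 := by
    have : Continuous fun p : ℝ × ℝ => (p.1, -N + 2 * N * p.2) := by fun_prop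
    exact (continuous_subtype_val.comp (hF.comp (hP.comp this)).fst).sub
      (continuous_subtype_val.comp (hr.comp continuous_fst))
  obtain ⟨σ, hσ, hσd⟩ : ∃ σ : ℝ, |σ| = 1 ∧ 1 ≤ σ * (d - 1) := by
    rcases abs_cases d with ⟨h1, h2⟩ | ⟨h1, h2⟩
    · refine ⟨1, by simp, ?_⟩
      have : (2 : ℝ) ≤ d := by exact_mod_cast (by omega : (2 : ℤ) ≤ d)
      linarith
    · refine ⟨-1, by simp, ?_⟩
      have : (d : ℝ) ≤ -2 := by exact_mod_cast (by omega : d ≤ (-2 : ℤ))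
      linarith
  have hNB : ∀ s ∈ Icc (0 : ℝ) 1, |σ * Y (s, 0)| < N := fun s hs => by
    rw [abs_mul, hσ, one_mul]
    exact (hB s hs).trans_lt hN
  have hN0 : (0 : ℝ) ≤ N := Nat.cast_nonneg N
  obtain ⟨p, hp1, hp2⟩ := exists_zero_of_signs (Y := fun p => σ * Y (p.1, -N + 2 * N * p.2)) hXc
    (by fun_prop)
    (fun t _ => by simp only [P, hr0]; linarith [h₀ (-N + 2 * N * t)])
    (fun t _ => by simp only [P, hr1]; linarith [h₁ (-N + 2 * N * t)])
    (fun s hs => by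
      have h1 := hYm s (-N : ℤ)
      push_cast at h1
      simp only [mul_zero, add_zero, h1]
      nlinarith [(abs_lt.1 (hNB s hs)).2])
    (fun s hs => by
      have h1 := hYm s (N : ℤ)
      push_cast at h1
      simp only [mul_one, show -(N : ℝ) + 2 * N = N by ring, h1]
      nlinarith [(abs_lt.1 (hNB s hs)).1])
  have hσ0 : σ ≠ 0 := fun h => by simp [h] at hσ
  refine ⟨P (p.1, -N + 2 * N * p.2), Prod.ext (Subtype.ext (sub_eq_zero.1 hp1)) ?_⟩
  exact sub_eq_zero.1 ((mul_eq_zero.1 hp2).resolve_left hσ0)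

/-- By periodicity a compact piece of the strip suffices. The period is a general `D` because the
radius of `F.symm` is only known to be invariant under multiples of `d`. -/
lemma exists_radial_bound {ρ : Strip → Ioo (0 : ℝ) 1} (hρ : Continuous ρ) {D : ℤ} (hD : D ≠ 0)
    (hper : ∀ m p, ρ (deck (D * m) p) = ρ p) {a b : ℝ} (ha : 0 < a) (hb : b < 1) :
    ∃ δ > 0, ∀ p : Strip, a ≤ p.1 → (p.1 : ℝ) ≤ b → δ < (ρ p : ℝ) ∧ (ρ p : ℝ) < 1 - δ := by
  have hDR : (0 : ℝ) < |(D : ℝ)| := abs_pos.2 (Int.cast_ne_zero.2 hD)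
  have hI : IsCompact (Subtype.val ⁻¹' Icc a b : Set (Ioo (0 : ℝ) 1)) := by
    rw [Subtype.isCompact_iff, Subtype.image_preimage_coe,
      inter_eq_right.2 (Icc_subset_Ioo ha hb)]
    exact isCompact_Icc
  have hK := hI.prod (isCompact_Icc (a := -|(D : ℝ)|) (b := |(D : ℝ)|))
  rcases (Subtype.val ⁻¹' Icc a b : Set (Ioo (0 : ℝ) 1)).eq_empty_or_nonempty with he | ⟨r, hr⟩
  · refine ⟨1, one_pos, fun p h1 h2 => ?_⟩
    exact absurd (show p.1 ∈ Subtype.val ⁻¹' Icc a b from ⟨h1, h2⟩) (by rw [he]; exact notMem_empty _)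
  have hf : Continuous fun p : Strip => min (ρ p : ℝ) (1 - ρ p) := by fun_prop
  obtain ⟨q, hq, hmin⟩ := hK.exists_isMinOn ⟨(r, 0), hr, by simp⟩ hf.continuousOn
  have hpos : 0 < min (ρ q : ℝ) (1 - ρ q) := lt_min (ρ q).2.1 (by linarith [(ρ q).2.2])
  refine ⟨min (ρ q : ℝ) (1 - ρ q) / 2, by linarith, fun p h1 h2 => ?_⟩
  have h3 : |p.2 + D * (-⌊p.2 / D⌋ : ℤ)| ≤ |(D : ℝ)| := by
    have hDn : (D : ℝ) ≠ 0 := Int.cast_ne_zero.2 hD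
    have h4 : p.2 + D * (-⌊p.2 / D⌋ : ℤ) = D * Int.fract (p.2 / D) := by
      rw [Int.fract, mul_sub, mul_div_cancel₀ _ hDn]
      push_cast
      ring
    rw [h4, abs_mul, abs_of_nonneg (Int.fract_nonneg (p.2 / D))]
    nlinarith [(Int.fract_lt_one (p.2 / D)).le]
  have h4 : min (ρ q : ℝ) (1 - ρ q) ≤
      min (ρ (deck (D * (-⌊p.2 / D⌋)) p) : ℝ) (1 - ρ (deck (D * (-⌊p.2 / D⌋)) p)) :=
    hmin ⟨⟨h1, h2⟩, abs_le.1 (by simpa [deck] using h3)⟩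
  rw [hper] at h4
  have h5 := le_min_iff.1 h4
  constructor <;> linarith

/-- By compactness `F` sends a neighbourhood of the end `1` off the middle radii, hence by
connectedness wholly to one side. It cannot stay away from the end `0`, for then nothing would be
mapped near that end. So it goes below `ε / 2`, and `exists_fixedPoint_of_radii` applies. -/
lemma exists_fixedPoint_of_flip {F : Strip ≃ₜ Strip} {d : ℤ} (hd : 1 < |d|)
    (hdeck : ∀ m p, F (deck m p) = deck (d * m) (F p)) {ε : ℝ} (hε : 0 < ε) (hε1 : ε < 1)
    (h : ∀ p : Strip, (p.1 : ℝ) < ε → ε ≤ (F p).1) : ∃ p, F p = p := by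
  have hd0 : d ≠ 0 := by
    rintro rfl
    simp at hd
  obtain ⟨δ, hδ, hback⟩ := exists_radial_bound (ρ := fun p => (F.symm p).1)
    F.symm.continuous.fst hd0 (fun m p => by
      have : F.symm (deck (d * m) p) = deck m (F.symm p) := by
        rw [Homeomorph.symm_apply_eq, hdeck, F.apply_symm_apply]
      rw [this]; rfl) (a := ε / 2) (b := 1 - ε / 2) (by linarith) (by linarith)
  have hback' : ∀ p : Strip, 1 - δ ≤ (p.1 : ℝ) → ((F p).1 : ℝ) ∉ Icc (ε / 2) (1 - ε / 2) :=
    fun p hp hmem => by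
      have := (hback (F p) hmem.1 hmem.2).2
      simp only [F.symm_apply_apply] at this
      linarith
  obtain ⟨η, hη, hfwd⟩ := exists_radial_bound (ρ := fun p => (F p).1) F.continuous.fst one_ne_zero
    (fun m p => by rw [one_mul, hdeck]; rfl) (a := ε) (b := 1 - δ) hε (by linarith)
  set T : Set Strip := (Subtype.val ⁻¹' Ici (1 - δ)) ×ˢ univ
  have hT : IsPreconnected T := (isPreconnected_radial ordConnected_Ici).prod isPreconnected_univ
  have hTF : IsPreconnected ((fun p => ((F p).1 : ℝ)) '' T) :=
    hT.image _ (continuous_subtype_val.comp F.continuous.fst).continuousOn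
  by_cases hlow : ∀ p : Strip, 1 - δ ≤ (p.1 : ℝ) → ((F p).1 : ℝ) < ε / 2
  · have hm0 : 0 < min δ (ε / 2) := lt_min hδ (by linarith)
    have hm1 := min_le_left δ (ε / 2)
    have hm2 := min_le_right δ (ε / 2)
    refine exists_fixedPoint_of_radii F.continuous hd hdeck
      (r₀ := ⟨ε / 2, by linarith, by linarith⟩)
      (r₁ := ⟨1 - min δ (ε / 2), by linarith, by linarith⟩) (fun y => ?_) (fun y => ?_)
    · have h1 := h (⟨ε / 2, by linarith, by linarith⟩, y) (show ε / 2 < ε by linarith)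
      exact (show ε / 2 < ε by linarith).trans_le h1
    · have h1 := hlow (⟨1 - min δ (ε / 2), by linarith, by linarith⟩, y)
        (show 1 - δ ≤ 1 - min δ (ε / 2) by linarith)
      exact h1.trans (show ε / 2 < 1 - min δ (ε / 2) by linarith)
  · push Not at hlow
    obtain ⟨q, hq, hqF⟩ := hlow
    have hhigh : ∀ p : Strip, 1 - δ ≤ (p.1 : ℝ) → ε / 2 < ((F p).1 : ℝ) := fun p hp => by
      by_contra! hcon
      obtain ⟨p', hp', heq⟩ := hTF.ordConnected.out ⟨p, ⟨hp, trivial⟩, rfl⟩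
        ⟨q, ⟨hq, trivial⟩, rfl⟩ (show ε / 2 ∈ Icc _ _ from ⟨hcon, hqF⟩)
      exact hback' p' hp'.1 (by
        simp only at heq
        rw [heq]
        constructor <;> linarith)
    exfalso
    have hm0 : 0 < min η (ε / 2) := lt_min hη (by linarith)
    have hm1 := min_le_left η (ε / 2)
    have hm2 := min_le_right η (ε / 2)
    set w : Strip := (⟨min η (ε / 2), by linarith, by linarith⟩, 0)
    have hw : ((F (F.symm w)).1 : ℝ) = min η (ε / 2) := by rw [F.apply_symm_apply]
    rcases lt_or_ge ((F.symm w).1 : ℝ) ε with h1 | h1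
    · linarith [h _ h1]
    rcases le_or_gt (1 - δ) ((F.symm w).1 : ℝ) with h2 | h2
    · linarith [hhigh _ h2]
    · linarith [(hfwd _ h1 h2.le).1]

/-- The reflection of the strip that interchanges its ends. -/
def reflect : Strip ≃ₜ Strip where
  toFun p := (⟨1 - p.1, by linarith [p.1.2.2], by linarith [p.1.2.1]⟩, p.2)
  invFun p := (⟨1 - p.1, by linarith [p.1.2.2], by linarith [p.1.2.1]⟩, p.2)
  left_inv p := by simp
  right_inv p := by simp
  continuous_toFun := by fun_prop
  continuous_invFun := by fun_prop

lemma exists_fixedPoint_of_flip' {F : Strip ≃ₜ Strip} {d : ℤ} (hd : 1 < |d|)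
    (hdeck : ∀ m p, F (deck m p) = deck (d * m) (F p)) {ε : ℝ} (hε : 0 < ε) (hε1 : ε < 1)
    (h : ∀ p : Strip, 1 - ε < (p.1 : ℝ) → ((F p).1 : ℝ) ≤ 1 - ε) : ∃ p, F p = p := by
  have hinv : ∀ p, reflect (reflect p) = p := fun p => reflect.left_inv p
  obtain ⟨p, hp⟩ := exists_fixedPoint_of_flip (F := (reflect.trans F).trans reflect) hd
    (fun m p => by
      have h1 : ∀ m p, reflect (deck m p) = deck m (reflect p) := fun m p => rfl
      simp only [Homeomorph.trans_apply, h1, hdeck]) hε hε1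
    (fun p hp => by
      have h1 := h (reflect p) (show 1 - ε < 1 - (p.1 : ℝ) by linarith)
      change ε ≤ 1 - ((F (reflect p)).1 : ℝ)
      linarith)
  refine ⟨reflect p, ?_⟩
  have h2 : reflect (F (reflect p)) = p := hp
  rw [← hinv (F (reflect p)), h2]

/-! ### The absorbing region cut off by a fundamental domain -/

/-- A path in `Q` to the image of a point of `C` lifts to a path ending in a deck translate of that
point, which is still in `C`. In the application `C` is the part of the strip near one end. -/
lemma isPreconnected_preimage_proj {Q : Set Annulus} (hQo : IsOpen Q) (hQ : IsPreconnected Q)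
    {C : Set Strip} (hC : IsPreconnected C) (hne : C.Nonempty) (hCQ : C ⊆ proj ⁻¹' Q)
    (hdeck : ∀ m, ∀ p ∈ C, deck m p ∈ C) : IsPreconnected (proj ⁻¹' Q) := by
  obtain ⟨c, hc⟩ := hne
  refine isPreconnected_of_forall c fun x hx => ?_
  have hconn : IsConnected Q := ⟨⟨_, hx⟩, hQ⟩
  obtain ⟨p, hp⟩ := (hQo.isConnected_iff_isPathConnected.1 hconn).joinedIn _ hx _ (hCQ hc)
  obtain ⟨Γ, hΓ, hΓp⟩ := exists_proj_lift p.extend p.continuous_extend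
  obtain ⟨m, hm⟩ := proj_eq_iff.1 ((hΓp 0).trans p.extend_zero)
  obtain ⟨k, hk⟩ := proj_eq_iff.1 ((hΓp 1).trans p.extend_one)
  set R := range fun s => deck (-m) (Γ s)
  have hxR : x ∈ R := ⟨0, by simp only [hm, deck_deck, add_neg_cancel, deck_zero]⟩
  have h1R : deck (-m) (Γ 1) ∈ R := ⟨1, rfl⟩
  have h1C : deck (-m) (Γ 1) ∈ C := hdeck _ _ (hk ▸ hdeck _ _ hc)
  refine ⟨R ∪ C, union_subset ?_ hCQ, .inr hc, .inl hxR,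
    (isPreconnected_range ((continuous_deck _).comp hΓ)).union _ h1R h1C hC⟩
  rintro _ ⟨s, rfl⟩
  change proj (deck (-m) (Γ s)) ∈ Q
  rw [proj_deck, hΓp]
  exact hp _

lemma IsStripLift.isPreconnected_preimage {f : Annulus → Annulus} {d : ℤ} {F : Strip ≃ₜ Strip}
    (hF : IsStripLift f d F) {Q : Set Annulus} (hQ : IsPreconnected (proj ⁻¹' Q)) :
    IsPreconnected (f ⁻¹' Q) := by
  have h1 : f ⁻¹' Q = proj '' (F.symm '' (proj ⁻¹' Q)) := by
    ext x
    constructor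
    · intro hx
      obtain ⟨p, rfl⟩ := proj_surjective x
      refine ⟨p, ⟨F p, ?_, F.symm_apply_apply p⟩, rfl⟩
      rw [mem_preimage, hF.proj_apply]
      exact hx
    · rintro ⟨_, ⟨q, hq, rfl⟩, rfl⟩
      rw [mem_preimage, hF.proj_symm_apply]
      exact hq
  rw [h1]
  exact (hQ.image _ F.symm.continuous.continuousOn).image _ continuous_proj.continuousOn

lemma exists_orbit {X : Type*} {f : X → X} (w : ℕ → X) (hw : ∀ n, f (w (n + 1)) = w n) :
    ∃ z : InverseLimit f, ∀ n : ℕ, z.1 (-n) = w n := by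
  refine ⟨⟨fun k => f^[k.toNat] (w (-k).toNat), fun k => ?_⟩, fun n => by simp⟩
  dsimp only
  rcases le_or_gt 0 k with hk | hk
  · rw [show (k + 1).toNat = k.toNat + 1 by omega, show (-(k + 1)).toNat = 0 by omega,
      show (-k).toNat = 0 by omega, Function.iterate_succ_apply']
  · rw [show (k + 1).toNat = 0 by omega, show (-k).toNat = (-(k + 1)).toNat + 1 by omega,
      show k.toNat = 0 by omega]
    exact (hw _).symm

lemma exists_orbit_through {X : Type*} {f : X → X} (hf : Function.Surjective f) (x : X) :
    ∃ z : InverseLimit f, z.1 0 = x := by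
  choose s hs using hf
  obtain ⟨z, hz⟩ := exists_orbit (f := f) (fun n => s^[n] x)
    (fun n => by rw [Function.iterate_succ_apply', hs])
  exact ⟨z, by simpa using hz 0⟩

/-- `P` is closed and absorbing: `f` maps it into itself, `f²` into its interior, and every
two-sided orbit enters it at a finite time. -/
structure IsAbsorbing (f : Annulus → Annulus) (P : Set Annulus) : Prop where
  isClosed : IsClosed P
  mapsTo : MapsTo f P P
  mapsTo_interior : MapsTo f (interior P) (interior P)
  iterate_two : ∀ x ∈ P, f (f x) ∈ interior P
  enters : ∀ z : InverseLimit f, ∃ n, z.1 n ∈ P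
  outside : ∀ z : InverseLimit f, ∃ n, z.1 n ∉ P

/-- If `x ∈ P` and `f (f x) ∉ interior P`, then `x`, `f x` and `f (f x)` all lie in `frontier P ⊆
A₀`, three visits of one orbit. A visit to `A₀` at time `n` puts the orbit in `P` at time `n + 1`
and outside `P` at time `n - 2`. -/
lemma IsFundamentalDomain.isAbsorbing {f : Annulus → Annulus} {A₀ P : Set Annulus}
    (hA : IsFundamentalDomain f A₀) (hopen : IsOpenMap f) (hsurj : Function.Surjective f)
    (hcl : IsClosed P) (hP : MapsTo f P P) (hAP : f '' A₀ ⊆ P) (hfr : frontier P ⊆ A₀)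
    (hint : Disjoint (interior P) A₀) : IsAbsorbing f P := by
  have hmi : MapsTo f (interior P) (interior P) := fun x hx =>
    interior_maximal ((image_mono interior_subset).trans hP.image_subset)
      (hopen _ isOpen_interior) ⟨x, hx, rfl⟩
  have htwo : ∀ x ∈ P, f (f x) ∈ interior P := fun x hx => by
    by_contra hcon
    have h1 : f x ∉ interior P := fun h => hcon (hmi h)
    have h0 : x ∉ interior P := fun h => h1 (hmi h)
    have hA' : ∀ y ∈ P, y ∉ interior P → y ∈ A₀ := fun y hy hyi =>
      hfr (hcl.frontier_eq ▸ ⟨hy, hyi⟩)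
    obtain ⟨z, rfl⟩ := exists_orbit_through hsurj x
    have e1 : z.1 1 = f (z.1 0) := z.2 0
    have e2 : z.1 2 = f (f (z.1 0)) := (z.2 1).trans (by rw [e1])
    have hsub : ({0, 1, 2} : Set ℤ) ⊆ {n : ℤ | z.1 n ∈ A₀} := by
      rintro n (rfl | rfl | rfl)
      · exact hA' _ hx h0
      · simp only [mem_ofPred_eq, e1]
        exact hA' _ (hP hx) h1
      · simp only [mem_ofPred_eq, e2]
        exact hA' _ (hP (hP hx)) hcon
    have hle := (encard_le_encard hsub).trans (hA.hits z).2
    have h3 : ({0, 1, 2} : Set ℤ).encard = 3 :=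
      encard_eq_three.2 ⟨0, 1, 2, by norm_num, by norm_num, by norm_num, rfl⟩
    rw [h3] at hle
    exact absurd hle (by norm_num)
  have hhit : ∀ z : InverseLimit f, ∃ n, z.1 n ∈ A₀ := fun z => by
    have := (hA.hits z).1
    exact one_le_encard_iff_nonempty.1 this
  refine ⟨hcl, hP, hmi, htwo, fun z => ?_, fun z => ?_⟩
  · obtain ⟨n, hn⟩ := hhit z
    exact ⟨n + 1, hAP ⟨_, hn, (z.2 n).symm⟩⟩
  · obtain ⟨n, hn⟩ := hhit z
    refine ⟨n - 2, fun hmem => ?_⟩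
    have h1 := htwo _ hmem
    rw [← z.2, ← z.2, show n - 2 + 1 + 1 = n by ring] at h1
    exact Set.disjoint_left.1 hint h1 hn

lemma IsFundamentalDomain.not_fixed {f : Annulus → Annulus} {A₀ : Set Annulus}
    (hA : IsFundamentalDomain f A₀) (x : Annulus) : f x ≠ x := fun hx => by
  obtain ⟨h1, h2⟩ := hA.hits ⟨fun _ => x, fun _ => hx.symm⟩
  by_cases h : x ∈ A₀ <;> simp [h] at h1 h2

/-- `f ⁻¹' (Wa ∪ O)` is connected and misses `A₀ ⊇ K`, so it lies in `Wa` or in `Wb`. The first case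
is invariance of the complement; in the second, `f` sends the end region given by `S` off itself,
which `hflip` excludes. -/
lemma IsFundamentalDomain.isAbsorbing_of_side {f : Annulus → Annulus} {A₀ K O Wa Wb : Set Annulus}
    (hA : IsFundamentalDomain f A₀) (hopen : IsOpenMap f) {d : ℤ} {F : Strip ≃ₜ Strip}
    (hF : IsStripLift f d F) (hKO : K ⊆ O) (hOA : O ⊆ A₀) (hAO : A₀ ⊆ closure O) (hOo : IsOpen O)
    (hac : IsClosed A₀) (hWa : IsOpen Wa) (hWb : IsOpen Wb) (hdisj : Disjoint Wa Wb)
    (hun : Wa ∪ Wb = Kᶜ) (hpre : IsPreconnected (Wa ∪ O)) (hfA : f '' A₀ ⊆ Wb \ O)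
    {S : Set ℝ} (hS : S.OrdConnected) {r : Ioo (0 : ℝ) 1} (hr : (r : ℝ) ∈ S)
    (hSW : ∀ x : Annulus, (x.1 : ℝ) ∈ S → x ∈ Wa)
    (hflip : ¬ ∀ p : Strip, (p.1 : ℝ) ∈ S → ((F p).1 : ℝ) ∉ S) :
    IsAbsorbing f (Wa ∪ O)ᶜ := by
  have hQo : IsOpen (Wa ∪ O) := hWa.union hOo
  have hAP : f '' A₀ ⊆ (Wa ∪ O)ᶜ := fun x hx hxQ =>
    hxQ.elim (fun h => Set.disjoint_left.1 hdisj h (hfA hx).1) (hfA hx).2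
  have hmem : ∀ x, x ∉ Wa ∪ O → x ∈ Wb := fun x hx => by
    have h1 : x ∈ Wa ∪ Wb := hun ▸ fun hxK => hx (.inr (hKO hxK))
    exact h1.resolve_left fun h => hx (.inl h)
  have hT : IsPreconnected (f ⁻¹' (Wa ∪ O)) := by
    refine hF.isPreconnected_preimage (isPreconnected_preimage_proj hQo hpre
      (C := (Subtype.val ⁻¹' S) ×ˢ univ)
      ((isPreconnected_radial hS).prod isPreconnected_univ) ⟨(r, 0), hr, trivial⟩
      (fun p hp => .inl (hSW _ hp.1)) fun m p hp => ⟨hp.1, trivial⟩)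
  have hTA : ∀ x, f x ∈ Wa ∪ O → x ∉ A₀ := fun x hx hxA => hAP ⟨x, hxA, rfl⟩ hx
  have hTsub : f ⁻¹' (Wa ∪ O) ⊆ Wa ∪ Wb := fun x hx => by
    rw [hun]
    exact fun hxK => hTA x hx (hOA (hKO hxK))
  refine hA.isAbsorbing hopen hF.surjective hQo.isClosed_compl ?_ hAP ?_ ?_
  · intro x hx hfx
    rcases hT.subset_or_subset hWa hWb hdisj hTsub with h | h
    · exact hx (.inl (h hfx))
    · refine hflip fun p hp hpF => ?_
      have h1 : proj p ∈ Wa := hSW _ hp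
      have h2 : f (proj p) ∈ Wa ∪ O := by
        rw [← hF.proj_apply]
        exact .inl (hSW _ hpF)
      exact Set.disjoint_left.1 hdisj h1 (h h2)
  · intro x hx
    by_contra hxA
    rw [hQo.isClosed_compl.frontier_eq] at hx
    refine hx.2 (mem_interior.2 ⟨Wb \ A₀, ?_, hWb.sdiff hac, hmem x hx.1, hxA⟩)
    rintro y ⟨hyb, hyA⟩ (hya | hyO)
    · exact Set.disjoint_left.1 hdisj hya hyb
    · exact hyA (hOA hyO)
  · rw [Set.disjoint_left]
    intro x hx hxA
    obtain ⟨y, hy1, hy2⟩ := mem_closure_iff.1 (hAO hxA) _ isOpen_interior hx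
    exact interior_subset hy1 (.inr hy2)

/-- A fundamental domain cuts off an absorbing region, disjoint from an essential closed curve. -/
theorem IsFundamentalDomain.exists_isAbsorbing {f : C(Annulus, Annulus)} {A₀ : Set Annulus}
    (hA : IsFundamentalDomain f A₀) (hf : IsCoveringMap f) {d : ℤ} (hd : 1 < |d|)
    {F : Strip ≃ₜ Strip} (hF : IsStripLift f d F) :
    ∃ P, IsAbsorbing f P ∧ ∃ (γ : C(Circle, Annulus)) (m : ℤ), m ≠ 0 ∧ HasWindingNumber γ m ∧
      ∀ w, γ w ∉ P := by
  obtain ⟨e⟩ := hA.annulus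
  obtain ⟨G, h, m, hm, hwind⟩ := exists_annulusParam e hA.essential
  obtain ⟨W₀, W₁, hW⟩ := h.exists_separation hm hwind
  obtain ⟨ε, hε, hε1, hE₀, hE₁⟩ := hW.ends
  have hopen : IsOpenMap f := hf.isLocalHomeomorph.isOpenMap
  have hKO : range (h.circle (1 / 2)) ⊆ h.core := by
    rintro _ ⟨w, rfl⟩
    exact ⟨(1 / 2, w), ⟨by norm_num, trivial⟩, rfl⟩
  have hfO : f '' A₀ ⊆ h.coreᶜ := fun x hx hxO => Set.disjoint_left.1 hA.disjoint_interior hx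
    (interior_maximal h.core_subset h.isOpen_core hxO)
  have hfc : IsPreconnected (f '' A₀) := h.isPreconnected.image _ f.continuous.continuousOn
  have hfW : f '' A₀ ⊆ W₀ ∪ W₁ := by
    rw [hW.union]
    exact hfO.trans (compl_subset_compl.2 hKO)
  have hnofix : ∀ p, F p ≠ p := fun p hp => hA.not_fixed (proj p) (by rw [← hF.proj_apply, hp])
  have hγ : ∀ (W : Set Annulus) w, h.circle (1 / 2) w ∉ (W ∪ h.core)ᶜ := fun W w hw =>
    hw (.inr (hKO ⟨w, rfl⟩))
  -- `P` is taken on the side of `f(A₀)`; the end on the opposite side is the one tested for a flip.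
  rcases hfc.subset_or_subset hW.isOpen₀ hW.isOpen₁ hW.disjoint hfW with h0 | h1
  · refine ⟨(W₁ ∪ h.core)ᶜ, ?_, _, m, hm, hwind, hγ _⟩
    refine hA.isAbsorbing_of_side hopen hF hKO h.core_subset h.subset_closure_core h.isOpen_core
      h.isCompact.isClosed hW.isOpen₁ hW.isOpen₀ hW.disjoint.symm (by rw [union_comm, hW.union])
      hW.preconnected₁ (fun x hx => ⟨h0 hx, hfO hx⟩) (ordConnected_Ioi (a := 1 - ε))
      (r := ⟨1 - ε / 2, by linarith, by linarith⟩) (show 1 - ε < 1 - ε / 2 by linarith) hE₁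
      fun hflip => ?_
    obtain ⟨p, hp⟩ := exists_fixedPoint_of_flip' hd hF.apply_deck hε hε1
      (fun p hp => not_lt.1 (hflip p hp))
    exact hnofix p hp
  · refine ⟨(W₀ ∪ h.core)ᶜ, ?_, _, m, hm, hwind, hγ _⟩
    refine hA.isAbsorbing_of_side hopen hF hKO h.core_subset h.subset_closure_core h.isOpen_core
      h.isCompact.isClosed hW.isOpen₀ hW.isOpen₁ hW.disjoint hW.union
      hW.preconnected₀ (fun x hx => ⟨h1 hx, hfO hx⟩) (ordConnected_Iio (a := ε))
      (r := ⟨ε / 2, by linarith, by linarith⟩) (show ε / 2 < ε by linarith) hE₀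
      fun hflip => ?_
    obtain ⟨p, hp⟩ := exists_fixedPoint_of_flip hd hF.apply_deck hε hε1
      (fun p hp => not_lt.1 (hflip p hp))
    exact hnofix p hp

/-! ### Locally finite sums -/

lemma summable_of_locally_eventually_zero {X : Type*} [TopologicalSpace X] {T : ℕ → X → ℝ}
    (h : ∀ x₀, ∃ N, ∀ᶠ x in 𝓝 x₀, ∀ n ≥ N, T n x = 0) (x : X) : Summable fun n => T n x := by
  obtain ⟨N, hN⟩ := h x
  refine summable_of_ne_finset_zero (s := Finset.range N) fun n hn => ?_
  exact hN.self_of_nhds n (by simpa using hn)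

lemma continuous_tsum_of_locally_eventually_zero {X : Type*} [TopologicalSpace X] {T : ℕ → X → ℝ}
    (hT : ∀ n, Continuous (T n)) (h : ∀ x₀, ∃ N, ∀ᶠ x in 𝓝 x₀, ∀ n ≥ N, T n x = 0) :
    Continuous fun x => ∑' n, T n x := by
  refine continuous_iff_continuousAt.2 fun x₀ => ?_
  obtain ⟨N, hN⟩ := h x₀
  have h1 : Continuous fun x => ∑ n ∈ Finset.range N, T n x := by fun_prop
  refine h1.continuousAt.congr ?_
  filter_upwards [hN] with x hx
  exact (tsum_eq_sum fun n hn => hx n (by simpa using hn)).symm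

/-! ### Orbits -/

lemma InverseLimit.apply_add {X : Type*} {f : X → X} (z : InverseLimit f) (k : ℤ) (n : ℕ) :
    z.1 (k + n) = f^[n] (z.1 k) := by
  induction n with
  | zero => simp
  | succ n ih => rw [Function.iterate_succ_apply', ← ih, ← z.2, add_assoc, Nat.cast_add, Nat.cast_one]

lemma InverseLimit.ext_of_neg {X : Type*} {f : X → X} {z z' : InverseLimit f}
    (h : ∀ n : ℕ, z.1 (-n) = z'.1 (-n)) : z = z' := by
  refine Subtype.ext (funext fun k => ?_)
  have h1 := z.apply_add (-k.natAbs) (k + k.natAbs).toNat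
  have h2 := z'.apply_add (-k.natAbs) (k + k.natAbs).toNat
  have h3 : -(k.natAbs : ℤ) + (k + k.natAbs).toNat = k := by omega
  rw [h3] at h1 h2
  rw [h1, h2, h]

/-- The `n`-th iterate of the shift. -/
def InverseLimit.shiftBy {X : Type*} {f : X → X} (n : ℤ) (z : InverseLimit f) : InverseLimit f :=
  ⟨fun k => z.1 (n + k), fun k => by rw [← z.2, add_assoc]⟩

lemma InverseLimit.continuous_eval {X : Type*} [TopologicalSpace X] {f : X → X} (n : ℤ) :
    Continuous fun z : InverseLimit f => z.1 n :=
  (continuous_apply n).comp continuous_subtype_val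

lemma InverseLimit.continuous_shiftBy {X : Type*} [TopologicalSpace X] {f : X → X} (n : ℤ) :
    Continuous (InverseLimit.shiftBy (f := f) n) :=
  (continuous_pi fun k => InverseLimit.continuous_eval (n + k)).subtype_mk _

lemma InverseLimit.shiftBy_add_one {X : Type*} [TopologicalSpace X] {f : X → X} (n : ℤ)
    (z : InverseLimit f) : InverseLimit.shiftBy (n + 1) z = shift f (InverseLimit.shiftBy n z) :=
  Subtype.ext (funext fun k => congrArg z.1 (by ring))

lemma InverseLimit.shiftBy_shift {X : Type*} [TopologicalSpace X] {f : X → X} (n : ℤ)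
    (z : InverseLimit f) : InverseLimit.shiftBy n (shift f z) = InverseLimit.shiftBy (n + 1) z :=
  Subtype.ext (funext fun k => congrArg z.1 (by ring))

/-! ### The cohomological equation -/

namespace IsAbsorbing

variable {f : Annulus → Annulus} {P : Set Annulus}

lemma orbit_mem (hP : IsAbsorbing f P) (z : InverseLimit f) {k n : ℤ} (hkn : k ≤ n)
    (hk : z.1 k ∈ P) : z.1 n ∈ P := by
  have h1 := z.apply_add k (n - k).toNat
  rw [show k + ((n - k).toNat : ℤ) = n by omega] at h1
  rw [h1]
  exact hP.mapsTo.iterate _ hk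

lemma exists_iterate_mem (hP : IsAbsorbing f P) (hf : Function.Surjective f) (x : Annulus) :
    ∃ n, f^[n] x ∈ P := by
  obtain ⟨z, rfl⟩ := exists_orbit_through hf x
  obtain ⟨n, hn⟩ := hP.enters z
  refine ⟨n.toNat, ?_⟩
  rw [← z.apply_add]
  exact hP.orbit_mem z (by omega) hn

lemma exists_cutoff (hP : IsAbsorbing f P) (hf : Continuous f) :
    ∃ b : Annulus → ℝ, Continuous b ∧ (∀ x ∈ P, b x = 1) ∧
      ∀ x, f (f x) ∉ interior P → b x = 0 := by
  have h1 : IsClosed {x | f (f x) ∈ interior P}ᶜ :=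
    (isOpen_interior.preimage (hf.comp hf)).isClosed_compl
  obtain ⟨b, hb0, hb1, -⟩ := exists_continuous_zero_one_of_isClosed h1 hP.isClosed
    (Set.disjoint_left.2 fun x hx hxP => hx (hP.iterate_two x hxP))
  exact ⟨b, b.continuous, fun x hx => hb1 hx, fun x hx => hb0 hx⟩

/-- A solution of the cohomological equation `u ∘ σ = d u - φ` on the inverse limit, which only
depends on the future as long as the past of the orbit is away from `P`. -/
lemma exists_cohomological_solution (hP : IsAbsorbing f P) (hf : Continuous f)
    (hs : Function.Surjective f) {φ : Annulus → ℝ} (hφ : Continuous φ) {d : ℤ} (hd : d ≠ 0) :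
    ∃ (g : Annulus → ℝ) (u : InverseLimit f → ℝ), Continuous g ∧ Continuous u ∧
      (∀ z, u (shift f z) = d * u z - φ (z.1 0)) ∧
      (∀ x, f (f x) ∉ interior P → g (f x) = d * g x - φ x) ∧
      ∀ z : InverseLimit f, (∀ n : ℕ, f (f (z.1 (-(n + 1)))) ∉ interior P) → u z = g (z.1 0) := by
  obtain ⟨b, hb, hb1, hb0⟩ := hP.exists_cutoff hf
  have hd' : (d : ℝ) ≠ 0 := Int.cast_ne_zero.2 hd
  -- `T` vanishes once the orbit is in `P`, `V` as long as it is two steps short of `interior P`.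
  -- Hence only finitely many terms matter near each point, whatever the growth of `φ`.
  set T : ℕ → Annulus → ℝ := fun n x => (1 - b (f^[n] x)) * φ (f^[n] x) / (d : ℝ) ^ (n + 1) with hT
  set V : ℕ → InverseLimit f → ℝ :=
    fun n z => b (z.1 (-(n + 1))) * φ (z.1 (-(n + 1))) * (d : ℝ) ^ n with hV
  have hTc : ∀ n, Continuous (T n) := fun n => by
    have := hf.iterate n
    fun_prop
  have hVc : ∀ n, Continuous (V n) := fun n => by
    have := InverseLimit.continuous_eval (f := f) (-(n + 1))
    exact ((hb.comp this).mul (hφ.comp this)).mul continuous_const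
  have hT0 : ∀ x₀, ∃ N, ∀ᶠ x in 𝓝 x₀, ∀ n ≥ N, T n x = 0 := fun x₀ => by
    obtain ⟨k, hk⟩ := hP.exists_iterate_mem hs x₀
    -- Two further iterates reach `interior P`, an open condition that holds on a neighbourhood of
    -- `x₀`.
    refine ⟨k + 2, ?_⟩
    have h1 : f^[k + 2] x₀ ∈ interior P := by
      rw [Function.iterate_succ_apply', Function.iterate_succ_apply']
      exact hP.iterate_two _ hk
    filter_upwards [(isOpen_interior.preimage (hf.iterate (k + 2))).mem_nhds h1] with x hx n hn
    have h2 : f^[n] x ∈ P := by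
      rw [← Nat.sub_add_cancel hn, Function.iterate_add_apply]
      exact hP.mapsTo.iterate _ (interior_subset hx)
    simp [hT, hb1 _ h2]
  have hV0 : ∀ z₀, ∃ N, ∀ᶠ z in 𝓝 z₀, ∀ n ≥ N, V n z = 0 := fun z₀ => by
    obtain ⟨m, hm⟩ := hP.outside z₀
    refine ⟨(2 - m).toNat, ?_⟩
    filter_upwards [(hP.isClosed.isOpen_compl.preimage
      (InverseLimit.continuous_eval m)).mem_nhds hm] with z hz n hn
    have h2 : b (z.1 (-(n + 1))) = 0 := hb0 _ fun h => hz <| by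
      rw [← z.2, ← z.2] at h
      exact hP.orbit_mem z (by omega) (interior_subset h)
    simp only [hV, h2, zero_mul]
  set g : Annulus → ℝ := fun x => ∑' n, T n x with hg
  set v : InverseLimit f → ℝ := fun z => ∑' n, V n z with hv
  have hgf : ∀ x, g (f x) = d * g x - (1 - b x) * φ x := fun x => by
    have h1 := (summable_of_locally_eventually_zero hT0 x).tsum_eq_zero_add
    have h2 : ∀ n, T (n + 1) x = T n (f x) / d := fun n => by
      simp only [hT, Function.iterate_succ_apply]
      rw [div_div, ← pow_succ]
    simp only [h2, tsum_div_const] at h1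
    simp only [hg, h1]
    simp only [hT, Function.iterate_zero, id, zero_add, pow_one]
    field_simp
    ring
  have hvs : ∀ z, v (shift f z) = d * v z + b (z.1 0) * φ (z.1 0) := fun z => by
    have h1 := (summable_of_locally_eventually_zero hV0 (shift f z)).tsum_eq_zero_add
    have h2 : ∀ n, V (n + 1) (shift f z) = d * V n z := fun n => by
      simp only [hV]
      rw [show (shift f z).1 (-((n + 1 : ℕ) + 1)) = z.1 (-(n + 1)) from
        congrArg z.1 (by push_cast; ring), pow_succ]
      ring
    have h3 : V 0 (shift f z) = b (z.1 0) * φ (z.1 0) := by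
      simp only [hV]
      rw [show (shift f z).1 (-((0 : ℕ) + 1)) = z.1 0 from congrArg z.1 (by simp)]
      simp
    simp only [h2, h3, tsum_mul_left] at h1
    simp only [hv, h1]
    ring
  have hgc : Continuous g := continuous_tsum_of_locally_eventually_zero hTc hT0
  refine ⟨g, fun z => g (z.1 0) - v z, hgc,
    (hgc.comp (InverseLimit.continuous_eval 0)).sub
      (continuous_tsum_of_locally_eventually_zero hVc hV0), fun z => ?_, fun x hx => ?_,
      fun z hz => ?_⟩
  · have h1 : (shift f z).1 0 = f (z.1 0) := z.2 0
    simp only [h1, hgf, hvs]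
    ring
  · rw [hgf, hb0 x hx]
    ring
  · have : v z = 0 := by
      have h1 : ∀ n, V n z = 0 := fun n => by simp only [hV, hb0 _ (hz n), zero_mul]
      simp [hv, h1]
    simp [this]

end IsAbsorbing

/-! ### The semiconjugacy -/

/-- The map to the solenoid defined by a solution of the cohomological equation. -/
noncomputable def solenoidMap {f : Annulus → Annulus} {d : ℤ} {φ : Annulus → ℝ}
    (hφ : ∀ x, (f x).2 = x.2 ^ d * turn (φ x)) {u : InverseLimit f → ℝ}
    (hu : ∀ z, u (shift f z) = d * u z - φ (z.1 0)) (z : InverseLimit f) :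
    InverseLimit (circlePow d) :=
  ⟨fun n => (z.1 n).2 * turn (u (InverseLimit.shiftBy n z)), fun n => by
    have h0 : (InverseLimit.shiftBy n z).1 0 = z.1 n := congrArg z.1 (add_zero n)
    dsimp only
    rw [z.2, hφ, InverseLimit.shiftBy_add_one, hu, h0, circlePow, mul_zpow, ← turn_int_mul,
      sub_eq_add_neg, turn_add, turn_neg, mul_assoc, mul_left_comm (turn (φ (z.1 n))),
      mul_inv_cancel, mul_one]⟩

lemma continuous_solenoidMap {f : Annulus → Annulus} {d : ℤ} {φ : Annulus → ℝ}
    (hφ : ∀ x, (f x).2 = x.2 ^ d * turn (φ x)) {u : InverseLimit f → ℝ} (huc : Continuous u)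
    (hu : ∀ z, u (shift f z) = d * u z - φ (z.1 0)) : Continuous (solenoidMap hφ hu) :=
  Continuous.subtype_mk (continuous_pi fun n => (InverseLimit.continuous_eval n).snd.mul
    (continuous_turn.comp (huc.comp (InverseLimit.continuous_shiftBy n)))) _

lemma solenoidMap_shift {f : Annulus → Annulus} {d : ℤ} {φ : Annulus → ℝ}
    (hφ : ∀ x, (f x).2 = x.2 ^ d * turn (φ x)) {u : InverseLimit f → ℝ}
    (hu : ∀ z, u (shift f z) = d * u z - φ (z.1 0)) (z : InverseLimit f) :
    solenoidMap hφ hu (shift f z) = shift (circlePow d) (solenoidMap hφ hu z) := by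
  refine Subtype.ext (funext fun n => ?_)
  change (z.1 (n + 1)).2 * turn (u (InverseLimit.shiftBy n (shift f z))) =
    (z.1 (n + 1)).2 * turn (u (InverseLimit.shiftBy (n + 1) z))
  rw [InverseLimit.shiftBy_shift]

/-- `(F p).2 - d * p.2` is invariant under deck transformations, so it descends to the annulus. -/
lemma IsStripLift.exists_angular_cocycle {f : Annulus → Annulus} {d : ℤ} {F : Strip ≃ₜ Strip}
    (hF : IsStripLift f d F) : ∃ φ : Annulus → ℝ, Continuous φ ∧
      (∀ p, (F p).2 = d * p.2 + φ (proj p)) ∧ ∀ x, (f x).2 = x.2 ^ d * turn (φ x) := by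
  obtain ⟨φ, hφ, hφF⟩ := exists_descent (Θ := fun p : Strip => (F p).2 - d * p.2)
    (F.continuous.snd.sub (by fun_prop)) (fun x t => by
      have h1 := hF.apply_deck 1 (x, t)
      have h2 : deck 1 (x, t) = (x, t + 1) := by simp [deck]
      rw [h2] at h1
      simp only [h1, deck]
      push_cast
      ring)
  have h1 : ∀ p, (F p).2 = d * p.2 + φ (proj p) := fun p => by
    rw [show φ (proj p) = _ from hφF p.1 p.2]
    ring
  refine ⟨φ, hφ, h1, fun x => ?_⟩
  obtain ⟨p, rfl⟩ := proj_surjective x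
  rw [← hF.proj_apply]
  change turn (F p).2 = turn p.2 ^ d * _
  rw [h1, turn_add, turn_int_mul]

lemma surjective_of_add_period {q : ℝ → ℝ} (hq : Continuous q) {c a : ℝ} (ha : a ≠ 0)
    (h : ∀ t, q (t + c) = q t + a) : Function.Surjective q := by
  have hn : ∀ m : ℤ, q (m * c) = q 0 + m * a := fun m => by
    induction m with
    | zero => simp
    | succ i ih => push_cast at *; rw [add_mul, one_mul, h, ih]; ring
    | pred i ih =>
      have h1 := h ((-(i : ℝ) - 1) * c)
      rw [show (-(i : ℝ) - 1) * c + c = -i * c by ring] at h1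
      push_cast at *
      rw [ih] at h1
      linarith
  intro y
  have hcov : ∃ m m' : ℤ, q 0 + m * a ≤ y ∧ y ≤ q 0 + m' * a := by
    rcases lt_or_gt_of_ne ha with hneg | hpos
    · refine ⟨⌈(y - q 0) / a⌉, ⌊(y - q 0) / a⌋, ?_, ?_⟩
      · have := Int.le_ceil ((y - q 0) / a)
        rw [div_le_iff_of_neg hneg] at this
        linarith
      · have := Int.floor_le ((y - q 0) / a)
        rw [le_div_iff_of_neg hneg] at this
        linarith
    · refine ⟨⌊(y - q 0) / a⌋, ⌈(y - q 0) / a⌉, ?_, ?_⟩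
      · have := Int.floor_le ((y - q 0) / a)
        rw [le_div_iff₀ hpos] at this
        linarith
      · have := Int.le_ceil ((y - q 0) / a)
        rw [div_le_iff₀ hpos] at this
        linarith
  obtain ⟨m, m', h1, h2⟩ := hcov
  exact mem_range_of_exists_le_of_exists_ge hq ⟨_, (hn m).trans_le h1⟩ ⟨_, h2.trans_eq (hn m').symm⟩

/-- A function on the strip of degree one along deck transformations which is multiplied by `d`
by `F` on the past of `P` lets every point of the solenoid be followed backwards. -/
lemma exists_backward_sequence {f : Annulus → Annulus} {d : ℤ} (hd : d ≠ 0) {F : Strip ≃ₜ Strip}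
    (hF : IsStripLift f d F) {B : Set Strip} (hBF : ∀ p ∈ B, F.symm p ∈ B)
    (hBd : ∀ m, ∀ p ∈ B, deck m p ∈ B) {k : Strip → ℝ} (hkd : ∀ m p, k (deck m p) = k p + m)
    (hkF : ∀ p ∈ B, k (F p) = d * k p) {ς : ℕ → Circle} (hς : ∀ n, ς (n + 1) ^ d = ς n)
    (hstart : ∀ y, ∃ p ∈ B, k p = y) :
    ∃ w : ℕ → Strip, (∀ n, w n ∈ B) ∧ (∀ n, turn (k (w n)) = ς n) ∧
      ∀ n, f (proj (w (n + 1))) = proj (w n) := by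
  have hd' : (d : ℝ) ≠ 0 := Int.cast_ne_zero.2 hd
  choose y hy using fun n => turn_surjective (ς n)
  have ha : ∀ n, ∃ a : ℤ, d * y (n + 1) = y n + a := fun n => by
    rw [← turn_eq_iff, turn_int_mul, hy, hy, hς]
  choose a ha using ha
  obtain ⟨p₀, hp₀, hkp₀⟩ := hstart (y 0)
  -- The translation by `a n` selects the preimage on which `k` is exactly `y (n + 1)`, among the
  -- values `(y n + integer) / d`.
  let w : ℕ → Strip := fun n => n.rec p₀ fun n p => F.symm (deck (a n) p)
  have hw : ∀ n, w (n + 1) = F.symm (deck (a n) (w n)) := fun n => rfl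
  have hB : ∀ n, w n ∈ B := fun n => by
    induction n with
    | zero => exact hp₀
    | succ n ih => exact hBF _ (hBd _ _ ih)
  have hk : ∀ n, k (w n) = y n := fun n => by
    induction n with
    | zero => exact hkp₀
    | succ n ih =>
      have h1 := hkF _ (hB (n + 1))
      rw [hw, F.apply_symm_apply, hkd, ih, ← ha, ← hw] at h1
      exact (mul_left_cancel₀ hd' h1).symm
  exact ⟨w, hB, fun n => by rw [hk, hy], fun n => by rw [hw, hF.proj_symm_apply, proj_deck]⟩

theorem proposition3p8 (f : C(Annulus, Annulus)) (hf : IsCoveringMap f)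
    (d : ℤ) (hd : 1 < |d|) (hdeg : HasDegree f d)
    (hfd : ∃ A₀ : Set Annulus, IsFundamentalDomain f A₀) :
    ∃ h : InverseLimit f → InverseLimit (circlePow d),
      Continuous h ∧ Function.Surjective h ∧
        ∀ z : InverseLimit f, h (shift f z) = shift (circlePow d) (h z) := by
  obtain ⟨A₀, hA⟩ := hfd
  have hd0 : d ≠ 0 := by
    rintro rfl
    simp at hd
  obtain ⟨F, hF⟩ := exists_stripLift hf hdeg
  obtain ⟨P, hP, γ, m, hm, ⟨θ, hθ, hθγ, hθ1⟩, hγP⟩ := hA.exists_isAbsorbing hf hd hF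
  obtain ⟨φ, hφ, hφF, hφf⟩ := hF.exists_angular_cocycle
  obtain ⟨g, u, hg, huc, hu, hgf, hug⟩ :=
    hP.exists_cohomological_solution f.continuous hF.surjective hφ hd0
  refine ⟨solenoidMap hφf hu, continuous_solenoidMap hφf huc hu, fun s => ?_,
    solenoidMap_shift hφf hu⟩
  set B : Set Strip := {p | f (f (proj p)) ∉ interior P} with hB
  set k : Strip → ℝ := fun p => p.2 + g (proj p) with hk
  have hkd : ∀ m p, k (deck m p) = k p + m := fun m p => by
    simp only [hk, proj_deck]
    simp only [deck]
    ring
  obtain ⟨w, hwB, hws, hwf⟩ := exists_backward_sequence hd0 hF (B := B) (k := k)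
    (ς := fun n => s.1 (-n))
    (fun p hp h => hp (by rw [hF.proj_symm_apply] at h; exact hP.mapsTo_interior h))
    (fun m p hp h => hp (by rwa [proj_deck] at h)) hkd
    (fun p hp => by
      simp only [hk]
      rw [hφF, hF.proj_apply, hgf _ hp]
      ring)
    (fun n => by
      have := s.2 (-(n + 1 : ℕ))
      rw [show (-((n + 1 : ℕ) : ℤ)) + 1 = -n by push_cast; ring] at this
      exact this.symm)
    (fun y => by
      set Γ : ℝ → Strip := fun t => ((γ (turn t)).1, θ t)
      have hΓ : Continuous Γ := (γ.continuous.comp continuous_turn).fst.prodMk hθ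
      have hΓp : ∀ t, proj (Γ t) = γ (turn t) := fun t => Prod.ext rfl (hθγ t).symm
      have hΓ1 : ∀ t, Γ (t + 1) = deck m (Γ t) := fun t => by
        simp only [Γ, turn_add_one, hθ1, deck]
      have hΓn : ∀ (n : ℤ) t, Γ (t + n) = deck (m * n) (Γ t) := fun n t => by
        have h1 : turn (t + n) = turn t := turn_add_int t n
        have h3 : θ (t + n) = θ t + (m * n : ℤ) := by
          have hper : Function.Periodic (fun t => θ t - m * t) 1 := fun t => by
            simp only [hθ1]
            ring
          have := hper.int_mul n t
          simp only [mul_one] at this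
          push_cast
          linarith
        simp only [Γ, h1, h3, deck]
      -- Membership in `B` is a condition on the second iterate, so the lifted curve is pulled back
      -- twice; `d * d` turns of the parameter then produce one deck transformation by `m`, and `k`
      -- is unbounded both ways along `q`.
      set q : ℝ → Strip := fun t => F.symm (F.symm (Γ t))
      have hq : Continuous q := F.symm.continuous.comp (F.symm.continuous.comp hΓ)
      have hqd : ∀ t, q (t + (d * d : ℤ)) = deck m (q t) := fun t => by
        simp only [q, hΓn]
        rw [show m * (d * d) = d * (d * m) by ring, hF.symm_apply_deck, hF.symm_apply_deck]
      obtain ⟨t, ht⟩ := surjective_of_add_period (q := fun t => k (q t)) (a := m)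
        (hq.snd.add (hg.comp (continuous_proj.comp hq))) (Int.cast_ne_zero.2 hm)
        (fun t => by rw [hqd, hkd]) y
      refine ⟨q t, fun h => hγP (turn t) ?_, ht⟩
      rw [hF.proj_symm_apply, hF.proj_symm_apply, hΓp] at h
      exact interior_subset h)
  obtain ⟨z, hz⟩ := exists_orbit (f := f) (fun n => proj (w n)) hwf
  refine ⟨z, InverseLimit.ext_of_neg fun n => ?_⟩
  change (z.1 (-n)).2 * turn (u (InverseLimit.shiftBy (-n) z)) = s.1 (-n)
  have h0 : (InverseLimit.shiftBy (-(n : ℤ)) z).1 0 = proj (w n) :=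
    (congrArg z.1 (add_zero _)).trans (hz n)
  rw [hug _ fun j => ?_, h0, hz, ← hws n]
  · exact (turn_add _ _).symm
  · have h1 : (InverseLimit.shiftBy (-(n : ℤ)) z).1 (-(j + 1)) = proj (w (n + j + 1)) := by
      rw [← hz]
      exact congrArg z.1 (by push_cast; ring)
    rw [h1]
    exact hwB _
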